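/- Let $\lambda\in(0,\infty)$ and $\theta\in\mathbb R$. For a finite simple graph $G$ let $V_T(G)$ be the number of vertices of $G$ that are part of a triangle of $G$, and let $E(G)$ be the number of edges of $G$. Let $\mathbb P$ (with expectation $\mathbb E$) be the law of the Erdős–Rényi random graph $G_n\sim G(n,\lambda/n)$ on $n$ labelled vertices ($n\ge 2$, $n\geq\lambda$), put $\beta=\beta_n=\tfrac13+\frac{\theta}{\log n}$, and let $\mathbb P_\beta$ be the exponential random graph model $$\frac{d\mathbb P_\beta}{d\mathbb P}(G)=\frac{1}{Z_n(\beta)}\,e^{\beta\log n\,V_T(G)},\qquad Z_n(\beta)=\mathbb E\big[e^{\beta\log n\,V_T(G_n)}\big].$$ For $a\in[0,1]$ let, with the convention $0\log 0=0$, $$\Lambda(a,\theta,\lambda)=\theta a-(1-a)\log(1-a)-\tfrac13a\log(\tfrac13a)-\tfrac23a-\tfrac13a\log 6+a\log\lambda .$$ Then $a\mapsto\Lambda(a,\theta,\lambda)$ has a unique maximizer $a^\star$ over $[0,1]$, this maximizer lies in $(0,1)$, and $$\lim_{n\to\infty}\frac1n\log Z_n(\beta)=\max_{a\in[0,1]}\Lambda(a,\theta,\lambda)=\Lambda(a^\star,\theta,\lambda).$$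 Furthermore, as $n\to\infty$, under $\mathbb P_\beta$, $$\frac{V_T(G_n)}{n}\to a^\star\quad\text{and}\quad\frac{E(G_n)}{n}\to\frac\lambda2+a^\star\qquad\text{in probability},$$ that is, for every $\varepsilon>0$, $\mathbb P_\beta(|V_T(G_n)/n-a^\star|>\varepsilon)\to0$ and $\mathbb P_\beta(|E(G_n)/n-\lambda/2-a^\star|>\varepsilon)\to0$. -/

import Mathlib

open MeasureTheory Filter Topology Set

namespace TriangleERGM

noncomputable section

/-- `V_T(G)`: the number of vertices of `G` that are part of a triangle of `G`. -/
def triangleVertexCount {n : ℕ} (G : SimpleGraph (Fin n)) : ℕ :=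
  {v : Fin n | ∃ u w : Fin n, G.Adj v u ∧ G.Adj v w ∧ G.Adj u w}.ncard

/-- `E(G)`: the number of edges of `G`. -/
def edgeCount {n : ℕ} (G : SimpleGraph (Fin n)) : ℕ :=
  G.edgeSet.ncard

/-- The edge probability `lam / n`. It is truncated to `[0, 1]`, which for `lam > 0` only matters
for the finitely many `n < lam`, where `lam / n` is not a probability. -/
def edgeProb (lam : ℝ) (n : ℕ) : unitInterval :=
  Set.projIcc (0 : ℝ) 1 zero_le_one (lam / n)

/-- The law of the Erdős–Rényi (binomial) random graph `G(n, lam / n)` on the vertex set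
`Fin n`. -/
def erdosRenyi (lam : ℝ) (n : ℕ) : Measure (SimpleGraph (Fin n)) :=
  SimpleGraph.binomialRandom (Fin n) (edgeProb lam n)

/-- The unnormalised density `exp(b * log n * V_T(G))` at inverse temperature `b`. -/
def weight (b : ℝ) {n : ℕ} (G : SimpleGraph (Fin n)) : ℝ :=
  Real.exp (b * Real.log n * triangleVertexCount G)

/-- The partition function `Z_n(b) = E[exp(b * log n * V_T(G_n))]`, for `G_n ∼ G(n, lam / n)`. -/
def partitionFunction (lam b : ℝ) (n : ℕ) : ℝ :=
  ∫ G, weight b G ∂(erdosRenyi lam n)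

/-- The exponential random graph: the measure with density `exp(b * log n * V_T(G)) / Z_n(b)`
with respect to the law of `G(n, lam / n)`. -/
def ergm (lam b : ℝ) (n : ℕ) : Measure (SimpleGraph (Fin n)) :=
  (erdosRenyi lam n).withDensity fun G =>
    ENNReal.ofReal (weight b G / partitionFunction lam b n)

/-- The critical inverse temperature `1 / 3 + θ / log n`. -/
def criticalBeta (θ : ℝ) (n : ℕ) : ℝ :=
  1 / 3 + θ / Real.log n

/-- The function `Λ(a, θ, lam)`, for `a ∈ [0, 1]`, with the convention `0 log 0 = 0`. -/
def rate (a θ lam : ℝ) : ℝ :=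
  θ * a - (1 - a) * Real.log (1 - a) - (1 / 3 * a) * Real.log (1 / 3 * a) - 2 / 3 * a
    - 1 / 3 * a * Real.log 6 + a * Real.log lam

/-- Convergence in probability to the constant `c` of random variables `X n` that may live on
different probability spaces `(Ω n, P n)`. -/
def TendstoInProb {Ω : ℕ → Type*} [∀ n, MeasurableSpace (Ω n)] (P : ∀ n, Measure (Ω n))
    (X : ∀ n, Ω n → ℝ) (c : ℝ) : Prop :=
  ∀ ε : ℝ, 0 < ε → Tendsto (fun n => P n {ω | ε < |X n ω - c|}) atTop (𝓝 0)

end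

end TriangleERGM

/-!
Everything follows from the free energy: for edge probabilities `p` with `n * p → lam` and vertex
weights `w = n ^ (1 / 3) * exp θ`, the limit of `(1 / n) * log E[w ^ V_T(G)]` is
`pressure (θ + log lam)`, the maximum of `rate · θ lam` (`tendsto_log_countExp`).

A family of `m` vertex-disjoint triangles costs `p ^ (3 * m)` and gains `w ^ (3 * m)`, and the
number of such families is `n! / (m! * 6 ^ m * (n - 3 * m)!)` by double counting
(`card_packings_eq`). At criticality energy and entropy balance on the scale `exp (O(n))`, and the
optimal `m` gives the maximum of the rate.

* Upper bound (`graphExp_pow_triangleVertexCount_le`). In any graph, take a maximal family `C` of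
  vertex-disjoint triangles and enlarge it to a maximal family `C ∪ D` of edge-disjoint ones. Each
  triangle of `D` brings at most two new vertices, and each remaining vertex in a triangle is joined
  to both ends of an edge of `C ∪ D` (`exists_triangle_cover`). A union bound over these structures
  shows that `D` and the remaining vertices contribute only `exp (O(n ^ (2 / 3)))`. The
  sum over `C` is `n!` times the coefficient of `x ^ n` in `exp (x + y * x ^ 3 / 6)`, with `y` close
  to `(w * p) ^ 3`, and is bounded at the saddle point (`sum_card_packings_le`).
* Lower bound (`le_graphExp_pow_triangleVertexCount`). Given `m` disjoint triangles, the expected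
  number of further triangles is bounded. By Markov's inequality the number of further triangles is
  at most a constant with probability at least one half, and a graph with that few further triangles
  contains only polynomially many families of `m` triangles. So the expected number of families is
  a lower bound for the probability of containing one, up to polynomial factors.

For the laws of large numbers, an exponential tilt by `s * V_T` turns `θ` into `θ + s`, and an
exponential tilt by `t * E` turns `lam` into `lam * exp t` at the price of an explicit factor
(`graphExp_exp_edgeCount`). Hence both scaled cumulant generating functions converge, with limits
`pressure (c + s) - pressure c` and `lam * (exp t - 1) / 2 + pressure (c + t) - pressure c`, where
`c = θ + log lam`. These are differentiable at `0`, because `pressure` is a convex conjugate with a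
unique maximizer (`hasDerivAt_pressure`), and Chernoff's bound gives the concentration
(`tendstoInProb_of_hasDerivAt`).
-/

namespace TriangleERGM

noncomputable section

variable {n : ℕ}

section FiniteGraphs

open scoped Classical

/-! ### The binomial random graph as a finite weighted sum -/

/-- The probability of the graph `G` under the binomial random graph on `Fin n` with edge
probability `p`. It is defined for every real `p`. -/
def graphProb {n : ℕ} (p : ℝ) (G : SimpleGraph (Fin n)) : ℝ :=
  p ^ edgeCount G * (1 - p) ^ (n.choose 2 - edgeCount G)

/-- The expectation of `f` under the binomial random graph with edge probability `p`. -/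
def graphExp {n : ℕ} (p : ℝ) (f : SimpleGraph (Fin n) → ℝ) : ℝ :=
  ∑ G, graphProb p G * f G

/-- The indicator of the event that all pairs in `A` are edges of `G`. -/
def present {n : ℕ} (A : Finset (Sym2 (Fin n))) (G : SimpleGraph (Fin n)) : ℝ :=
  if (A : Set (Sym2 (Fin n))) ⊆ G.edgeSet then 1 else 0

/-- All unordered pairs of distinct elements of the finset `t`: the edges of the complete graph
on `t`. -/
def pairs {n : ℕ} (t : Finset (Fin n)) : Finset (Sym2 (Fin n)) :=
  t.offDiag.image Sym2.mk.uncurry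

lemma mem_pairs {t : Finset (Fin n)} {a b : Fin n} :
    s(a, b) ∈ pairs t ↔ a ∈ t ∧ b ∈ t ∧ a ≠ b := by
  simp only [pairs, Finset.mem_image, Finset.mem_offDiag, Prod.exists, Function.uncurry_apply_pair,
    Sym2.eq_iff]
  constructor
  · rintro ⟨x, y, ⟨hx, hy, hxy⟩, ⟨rfl, rfl⟩ | ⟨rfl, rfl⟩⟩
    · exact ⟨hx, hy, hxy⟩
    · exact ⟨hy, hx, hxy.symm⟩
  · rintro ⟨ha, hb, hab⟩
    exact ⟨a, b, ⟨ha, hb, hab⟩, Or.inl ⟨rfl, rfl⟩⟩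

lemma card_pairs (t : Finset (Fin n)) : (pairs t).card = t.card.choose 2 :=
  Sym2.card_image_offDiag t

lemma pairs_mono {t u : Finset (Fin n)} (h : t ⊆ u) : pairs t ⊆ pairs u := by
  intro e
  induction e with | _ a b =>
  simp only [mem_pairs]
  exact fun ⟨ha, hb, hab⟩ => ⟨h ha, h hb, hab⟩

lemma edgeSet_subset_pairs_univ (G : SimpleGraph (Fin n)) :
    G.edgeSet ⊆ (pairs (Finset.univ : Finset (Fin n)) : Set (Sym2 (Fin n))) := by
  intro e
  induction e with | _ a b =>
  intro h
  have : G.Adj a b := h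
  simpa [mem_pairs] using this.ne

lemma not_isDiag_of_mem_pairs {t : Finset (Fin n)} {e : Sym2 (Fin n)} (h : e ∈ pairs t) :
    ¬ e.IsDiag := by
  induction e with | _ a b =>
  simpa using (mem_pairs.1 h).2.2

/-- Summing over graphs is summing over sets of pairs. -/
lemma sum_graph_eq (f : Finset (Sym2 (Fin n)) → ℝ) :
    ∑ G : SimpleGraph (Fin n), f G.edgeSet.toFinset
      = ∑ A ∈ (pairs (Finset.univ : Finset (Fin n))).powerset, f A := by
  refine Finset.sum_bij' (fun G _ => G.edgeSet.toFinset)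
    (fun A _ => SimpleGraph.fromEdgeSet (A : Set (Sym2 (Fin n)))) ?_ ?_ ?_ ?_ ?_
  · intro G _
    rw [Finset.mem_powerset, ← Finset.coe_subset, Set.coe_toFinset]
    exact edgeSet_subset_pairs_univ G
  · intro A _
    exact Finset.mem_univ _
  · intro G _
    simp
  · intro A hA
    rw [Finset.mem_powerset] at hA
    ext e
    simp only [SimpleGraph.edgeSet_fromEdgeSet, Set.mem_toFinset, Set.mem_sdiff, Finset.mem_coe]
    refine ⟨fun h => h.1, fun h => ⟨h, ?_⟩⟩
    have := not_isDiag_of_mem_pairs (hA h)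
    simpa using this
  · intro G _
    rfl

lemma edgeCount_eq (G : SimpleGraph (Fin n)) : edgeCount G = G.edgeSet.toFinset.card :=
  Set.ncard_eq_toFinset_card' _

lemma edgeCount_le (G : SimpleGraph (Fin n)) : edgeCount G ≤ n.choose 2 := by
  have h := Finset.card_le_card (Finset.coe_subset.1
    ((Set.coe_toFinset G.edgeSet).symm ▸ edgeSet_subset_pairs_univ G))
  rw [card_pairs, Finset.card_univ, Fintype.card_fin, ← edgeCount_eq] at h
  exact h

/-- The pairs in `A` are all edges of the random graph with probability `p ^ #A`. -/
lemma graphExp_present (p : ℝ) {A : Finset (Sym2 (Fin n))} (hA : A ⊆ pairs Finset.univ) :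
    graphExp p (present A) = p ^ A.card := by
  refine Eq.trans ?_ ((sum_graph_eq fun B : Finset (Sym2 (Fin n)) => (∏ _e ∈ B, p) *
    ∏ e ∈ pairs Finset.univ \ B, (if e ∈ A then 0 else 1 - p)).trans ?_)
  · refine Finset.sum_congr rfl fun G _ => ?_
    have hsub : G.edgeSet.toFinset ⊆ pairs Finset.univ := by
      rw [← Finset.coe_subset, Set.coe_toFinset]
      exact edgeSet_subset_pairs_univ G
    simp only [present, graphProb, Finset.prod_const, ← edgeCount_eq]
    split_ifs with h
    · rw [mul_one]
      congr 1
      rw [Finset.prod_congr rfl (g := fun _ => 1 - p), Finset.prod_const,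
        Finset.card_sdiff_of_subset hsub, card_pairs, Finset.card_univ, Fintype.card_fin,
        edgeCount_eq]
      intro e he
      rw [if_neg]
      intro heA
      exact (Finset.mem_sdiff.1 he).2 (by simpa using h heA)
    · rw [mul_zero]
      obtain ⟨e, heA, heG⟩ := Set.not_subset.1 h
      rw [Finset.prod_eq_zero (i := e), mul_zero]
      · exact Finset.mem_sdiff.2 ⟨hA heA, by simpa using heG⟩
      · rw [if_pos (by simpa using heA)]
  rw [← Finset.prod_add, Finset.prod_congr rfl (g := fun e => if e ∈ A then p else 1)]
  · rw [Finset.prod_ite, Finset.prod_const, Finset.prod_const_one, mul_one,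
      Finset.filter_mem_eq_inter, Finset.inter_eq_right.2 hA]
  · intro e _
    split_ifs <;> ring

lemma graphProb_nonneg {p : ℝ} (hp0 : 0 ≤ p) (hp1 : p ≤ 1) (G : SimpleGraph (Fin n)) :
    0 ≤ graphProb p G :=
  mul_nonneg (pow_nonneg hp0 _) (pow_nonneg (sub_nonneg.2 hp1) _)

lemma graphExp_mono {p : ℝ} (hp0 : 0 ≤ p) (hp1 : p ≤ 1) {f g : SimpleGraph (Fin n) → ℝ}
    (h : ∀ G, f G ≤ g G) : graphExp p f ≤ graphExp p g :=
  Finset.sum_le_sum fun G _ => mul_le_mul_of_nonneg_left (h G) (graphProb_nonneg hp0 hp1 G)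

lemma graphExp_add (p : ℝ) (f g : SimpleGraph (Fin n) → ℝ) :
    graphExp p (fun G => f G + g G) = graphExp p f + graphExp p g := by
  simp only [graphExp, mul_add, Finset.sum_add_distrib]

lemma graphExp_sub (p : ℝ) (f g : SimpleGraph (Fin n) → ℝ) :
    graphExp p (fun G => f G - g G) = graphExp p f - graphExp p g := by
  simp only [graphExp, mul_sub, Finset.sum_sub_distrib]

lemma graphExp_const_mul (p c : ℝ) (f : SimpleGraph (Fin n) → ℝ) :
    graphExp p (fun G => c * f G) = c * graphExp p f := by
  simp only [graphExp, Finset.mul_sum]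
  exact Finset.sum_congr rfl fun _ _ => by ring

lemma graphExp_sum {ι : Type*} (p : ℝ) (s : Finset ι) (f : ι → SimpleGraph (Fin n) → ℝ) :
    graphExp p (fun G => ∑ i ∈ s, f i G) = ∑ i ∈ s, graphExp p (f i) := by
  simp only [graphExp, Finset.mul_sum]
  exact Finset.sum_comm

lemma present_nonneg (A : Finset (Sym2 (Fin n))) (G : SimpleGraph (Fin n)) : 0 ≤ present A G := by
  unfold present; split_ifs <;> norm_num

lemma present_mul_present (A B : Finset (Sym2 (Fin n))) (G : SimpleGraph (Fin n)) :
    present A G * present B G = present (A ∪ B) G := by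
  simp only [present, Finset.coe_union, Set.union_subset_iff]
  split_ifs <;> simp_all

/-- Weighting each edge by `exp t` turns the edge probability `p` into
`p * exp t / (1 - p + p * exp t)`. -/
lemma graphExp_exp_edgeCount {p : ℝ} (hp0 : 0 ≤ p) (hp1 : p ≤ 1) (t : ℝ)
    (f : SimpleGraph (Fin n) → ℝ) :
    graphExp p (fun G => Real.exp (t * edgeCount G) * f G)
      = (1 - p + p * Real.exp t) ^ n.choose 2
        * graphExp (p * Real.exp t / (1 - p + p * Real.exp t)) f := by
  have hpos : 0 < 1 - p + p * Real.exp t := by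
    rcases hp0.eq_or_lt with rfl | h
    · simp
    · have := mul_pos h (Real.exp_pos t)
      linarith
  unfold graphExp
  rw [Finset.mul_sum]
  refine Finset.sum_congr rfl fun G _ => ?_
  have hc : 1 - p * Real.exp t / (1 - p + p * Real.exp t) = (1 - p) / (1 - p + p * Real.exp t) := by
    field_simp
    ring
  obtain ⟨k, hk⟩ := Nat.exists_eq_add_of_le (edgeCount_le G)
  have hexp : Real.exp (t * edgeCount G) = Real.exp t ^ edgeCount G := by
    rw [← Real.exp_nat_mul, mul_comm]
  simp only [graphProb, hc, hexp]
  rw [hk, Nat.add_sub_cancel_left, pow_add, div_pow, div_pow, mul_pow]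
  field_simp

/-- The law of the random graph, as a measure, gives a graph its mass `graphProb`. -/
lemma erdosRenyi_singleton (lam : ℝ) (G : SimpleGraph (Fin n)) :
    erdosRenyi lam n {G} = ENNReal.ofReal (graphProb (edgeProb lam n : ℝ) G) := by
  have h0 := (edgeProb lam n).2.1
  have h1 := (edgeProb lam n).2.2
  rw [erdosRenyi, SimpleGraph.binomialRandom_singleton, graphProb,
    ENNReal.ofReal_mul (pow_nonneg h0 _), ENNReal.ofReal_pow h0,
    ENNReal.ofReal_pow (sub_nonneg.2 h1), Nat.card_fin]
  congr 2
  · rw [← ENNReal.ofReal_coe_nnreal]; rfl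
  · rw [← ENNReal.ofReal_coe_nnreal]; rfl

instance : MeasurableSingletonClass (SimpleGraph (Fin n)) where
  measurableSet_singleton G := by
    have : ({G} : Set (SimpleGraph (Fin n))) = SimpleGraph.edgeSet ⁻¹' {G.edgeSet} := by
      ext H; simp
    rw [this]
    exact SimpleGraph.measurable_edgeSet (MeasurableSet.singleton _)

lemma integral_erdosRenyi (lam : ℝ) (f : SimpleGraph (Fin n) → ℝ) :
    ∫ G, f G ∂(erdosRenyi lam n) = graphExp (edgeProb lam n : ℝ) f := by
  have : IsProbabilityMeasure (erdosRenyi lam n) := by unfold erdosRenyi; infer_instance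
  rw [integral_fintype (Integrable.of_finite), graphExp]
  refine Finset.sum_congr rfl fun G _ => ?_
  rw [measureReal_def, erdosRenyi_singleton, ENNReal.toReal_ofReal
    (graphProb_nonneg (edgeProb lam n).2.1 (edgeProb lam n).2.2 G), smul_eq_mul]

/-- The exponential random graph measure of an event, as a quotient of two finite sums. -/
lemma ergm_apply (lam b : ℝ) (S : Set (SimpleGraph (Fin n))) :
    ergm lam b n S = ENNReal.ofReal
      (graphExp (edgeProb lam n : ℝ) (fun G => if G ∈ S then weight b G else 0)
        / partitionFunction lam b n) := by
  have h0 := (edgeProb lam n).2.1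
  have h1 := (edgeProb lam n).2.2
  have hZ : 0 ≤ partitionFunction lam b n :=
    integral_nonneg fun G => (Real.exp_pos _).le
  have hS : MeasurableSet S := S.toFinite.measurableSet
  have hm : Measurable fun G : SimpleGraph (Fin n) =>
      ENNReal.ofReal (weight b G / partitionFunction lam b n) := fun T _ =>
    (Set.toFinite _).measurableSet
  rw [ergm, withDensity_apply _ hS, ← lintegral_indicator hS, lintegral_fintype, graphExp,
    Finset.sum_div, ENNReal.ofReal_sum_of_nonneg]
  · refine Finset.sum_congr rfl fun G _ => ?_
    rw [erdosRenyi_singleton, Set.indicator_apply]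
    split_ifs with h
    · rw [← ENNReal.ofReal_mul (div_nonneg (show 0 ≤ weight b G from (Real.exp_pos _).le) hZ)]
      congr 1
      ring
    · simp
  · intro G _
    refine div_nonneg (mul_nonneg (graphProb_nonneg h0 h1 G) ?_) hZ
    split_ifs
    · exact (Real.exp_pos _).le
    · exact le_rfl

/-! ### Counting families of vertex-disjoint triangles -/

/-- The three-element sets of vertices: the possible triangles. -/
def triples (n : ℕ) : Finset (Finset (Fin n)) := Finset.univ.powersetCard 3

/-- The families of `m` pairwise vertex-disjoint triangles on `Fin n`. -/
def packings (n m : ℕ) : Finset (Finset (Finset (Fin n))) :=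
  ((triples n).powersetCard m).filter fun C => (C : Set (Finset (Fin n))).PairwiseDisjoint id

/-- The vertices covered by a family of triangles. -/
def covered (P : Finset (Finset (Fin n))) : Finset (Fin n) := P.biUnion id

/-- The edges of a family of triangles. -/
def famEdges (P : Finset (Finset (Fin n))) : Finset (Sym2 (Fin n)) := P.biUnion pairs

lemma mem_triples {t : Finset (Fin n)} : t ∈ triples n ↔ t.card = 3 := by
  simp [triples, Finset.mem_powersetCard]

lemma card_triples : (triples n).card = n.choose 3 := by
  simp [triples, Finset.card_powersetCard]

lemma mem_packings {m : ℕ} {C : Finset (Finset (Fin n))} :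
    C ∈ packings n m ↔ C ⊆ triples n ∧ C.card = m ∧
      (C : Set (Finset (Fin n))).PairwiseDisjoint id := by
  simp [packings, Finset.mem_powersetCard, and_assoc]

lemma mem_covered {P : Finset (Finset (Fin n))} {v : Fin n} :
    v ∈ covered P ↔ ∃ t ∈ P, v ∈ t := by
  simp [covered]

lemma mem_famEdges {P : Finset (Finset (Fin n))} {e : Sym2 (Fin n)} :
    e ∈ famEdges P ↔ ∃ t ∈ P, e ∈ pairs t := by
  simp [famEdges]

lemma famEdges_subset (P : Finset (Finset (Fin n))) : famEdges P ⊆ pairs Finset.univ :=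
  Finset.biUnion_subset.2 fun t _ => pairs_mono (Finset.subset_univ t)

lemma card_covered_of_mem_packings {m : ℕ} {C : Finset (Finset (Fin n))} (hC : C ∈ packings n m) :
    (covered C).card = 3 * m := by
  obtain ⟨h3, hm, hd⟩ := mem_packings.1 hC
  rw [covered, Finset.card_biUnion hd,
    Finset.sum_congr rfl fun t ht => show (id t).card = 3 from mem_triples.1 (h3 ht),
    Finset.sum_const, hm, smul_eq_mul, mul_comm]

lemma disjoint_pairs_of_disjoint {t u : Finset (Fin n)} (h : Disjoint t u) :
    Disjoint (pairs t) (pairs u) := by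
  rw [Finset.disjoint_left]
  intro e
  induction e with | _ a b =>
  intro h1 h2
  exact Finset.disjoint_left.1 h (mem_pairs.1 h1).1 (mem_pairs.1 h2).1

lemma card_famEdges {P : Finset (Finset (Fin n))} (h3 : P ⊆ triples n)
    (hd : (P : Set (Finset (Fin n))).PairwiseDisjoint pairs) :
    (famEdges P).card = 3 * P.card := by
  rw [famEdges, Finset.card_biUnion hd, Finset.sum_congr rfl fun t ht => by
    rw [card_pairs, mem_triples.1 (h3 ht)], Finset.sum_const, smul_eq_mul, mul_comm]
  rfl

lemma card_famEdges_of_mem_packings {m : ℕ} {C : Finset (Finset (Fin n))}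
    (hC : C ∈ packings n m) : (famEdges C).card = 3 * m := by
  obtain ⟨h3, hm, hd⟩ := mem_packings.1 hC
  rw [card_famEdges h3 fun t ht u hu htu => disjoint_pairs_of_disjoint (hd ht hu htu), hm]

/-- A family of `m` disjoint triangles extends by any triangle in the complement of the vertices
that it covers. -/
lemma card_packings_above {m : ℕ} {C : Finset (Finset (Fin n))} (hC : C ∈ packings n m) :
    ((packings n (m + 1)).filter fun C' => C ⊆ C').card = (n - 3 * m).choose 3 := by
  have hcov := card_covered_of_mem_packings hC
  obtain ⟨h3, hm, hd⟩ := mem_packings.1 hC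
  have hcard : ((covered C)ᶜ.powersetCard 3).card = (n - 3 * m).choose 3 := by
    rw [Finset.card_powersetCard, Finset.card_compl, hcov, Fintype.card_fin]
  have hnot : ∀ t ∈ (covered C)ᶜ.powersetCard 3, t ∉ C := by
    intro t ht htC
    obtain ⟨hsub, ht3⟩ := Finset.mem_powersetCard.1 ht
    obtain ⟨v, hv⟩ := Finset.card_pos.1 (show 0 < t.card by omega)
    exact (Finset.mem_compl.1 (hsub hv)) (mem_covered.2 ⟨t, htC, hv⟩)
  rw [← hcard]
  symm
  refine Finset.card_bij (fun t _ => insert t C) ?_ ?_ ?_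
  · intro t ht
    obtain ⟨hsub, ht3⟩ := Finset.mem_powersetCard.1 ht
    refine Finset.mem_filter.2 ⟨mem_packings.2 ⟨?_, ?_, ?_⟩, Finset.subset_insert _ _⟩
    · exact Finset.insert_subset (mem_triples.2 ht3) h3
    · rw [Finset.card_insert_of_notMem (hnot t ht), hm]
    · rw [Finset.coe_insert]
      refine hd.insert fun u hu _ => Finset.disjoint_left.2 fun v hv hvu => ?_
      exact (Finset.mem_compl.1 (hsub hv)) (mem_covered.2 ⟨u, hu, hvu⟩)
  · intro t ht u hu h
    have : t ∈ insert u C := h ▸ Finset.mem_insert_self t C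
    exact (Finset.mem_insert.1 this).resolve_right (hnot t ht)
  · intro C' hC'
    obtain ⟨hC', hsub⟩ := Finset.mem_filter.1 hC'
    obtain ⟨h3', hm', hd'⟩ := mem_packings.1 hC'
    obtain ⟨t, ht⟩ := Finset.card_eq_one.1
      (show (C' \ C).card = 1 by rw [Finset.card_sdiff_of_subset hsub, hm', hm]; omega)
    have htm : t ∈ C' ∧ t ∉ C := by
      have : t ∈ C' \ C := ht ▸ Finset.mem_singleton_self t
      simpa using this
    refine ⟨t, Finset.mem_powersetCard.2 ⟨?_, mem_triples.1 (h3' htm.1)⟩, ?_⟩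
    · intro v hv
      rw [Finset.mem_compl, mem_covered]
      rintro ⟨u, hu, hvu⟩
      have hne : t ≠ u := fun h => htm.2 (h ▸ hu)
      exact Finset.disjoint_left.1 (hd' htm.1 (hsub hu) hne) hv hvu
    · rw [Finset.insert_eq, ← ht, Finset.sdiff_union_of_subset hsub]

lemma card_packings_below {m : ℕ} {C' : Finset (Finset (Fin n))} (hC : C' ∈ packings n (m + 1)) :
    ((packings n m).filter fun C => C ⊆ C').card = m + 1 := by
  obtain ⟨h3, hm, hd⟩ := mem_packings.1 hC
  have : ((packings n m).filter fun C => C ⊆ C') = C'.powersetCard m := by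
    ext C
    rw [Finset.mem_filter, mem_packings, Finset.mem_powersetCard]
    exact ⟨fun h => ⟨h.2, h.1.2.1⟩, fun h =>
      ⟨⟨h.1.trans h3, h.2, hd.subset (Finset.coe_subset.2 h.1)⟩, h.1⟩⟩
  rw [this, Finset.card_powersetCard, hm, Nat.choose_succ_self_right]

/-- Double counting of the pairs of families `C ⊆ C'` of `m` and `m + 1` disjoint triangles. -/
lemma card_packings_succ (n m : ℕ) :
    (packings n m).card * (n - 3 * m).choose 3 = (packings n (m + 1)).card * (m + 1) :=
  Finset.card_mul_eq_card_mul (fun C C' : Finset (Finset (Fin n)) => C ⊆ C')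
    (fun _ hC => card_packings_above hC)
    fun _ hC => card_packings_below hC

lemma card_packings_mul {m : ℕ} (hm : 3 * m ≤ n) :
    (packings n m).card * (m.factorial * 6 ^ m * (n - 3 * m).factorial) = n.factorial := by
  induction m with
  | zero =>
    have : packings n 0 = {∅} := by
      ext C
      rw [mem_packings, Finset.mem_singleton]
      refine ⟨fun h => Finset.card_eq_zero.1 h.2.1, ?_⟩
      rintro rfl
      simp
    simp [this]
  | succ m ih =>
    have h := ih (by omega)
    rw [← h]
    have hs := card_packings_succ n m
    have hf : (n - 3 * m).factorial
        = (n - 3 * m).choose 3 * 6 * (n - 3 * (m + 1)).factorial := by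
      rw [← Nat.choose_mul_factorial_mul_factorial (show 3 ≤ n - 3 * m by omega)]
      congr 2
    rw [hf, Nat.factorial_succ]
    calc _ = ((packings n (m + 1)).card * (m + 1)) * (m.factorial * 6 ^ m * 6 *
          (n - 3 * (m + 1)).factorial) := by ring
      _ = _ := by rw [← hs]; ring

lemma card_packings_eq {m : ℕ} (hm : 3 * m ≤ n) :
    ((packings n m).card : ℝ)
      = n.factorial / (m.factorial * 6 ^ m * (n - 3 * m).factorial) := by
  rw [eq_div_iff (by positivity)]
  exact_mod_cast card_packings_mul hm

lemma packings_eq_empty {m : ℕ} (hm : n < 3 * m) : packings n m = ∅ := by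
  rw [Finset.eq_empty_iff_forall_notMem]
  intro C hC
  have h1 := card_covered_of_mem_packings hC
  have h2 := Finset.card_le_univ (covered C)
  rw [Fintype.card_fin] at h2
  omega

/-- A saddle point bound: the sum over all families of disjoint triangles is `n!` times the
coefficient of `r ^ n` in `exp (r + y * r ^ 3 / 6)`. -/
lemma sum_card_packings_le {y r : ℝ} (hy : 0 ≤ y) (hr : 0 < r) :
    ∑ m ∈ Finset.range (n + 1), ((packings n m).card : ℝ) * y ^ m
      ≤ n.factorial / r ^ n * Real.exp (r + y * r ^ 3 / 6) := by
  have hx : 0 ≤ y * r ^ 3 / 6 := by positivity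
  have hterm : ∀ m ∈ Finset.range (n + 1), ((packings n m).card : ℝ) * y ^ m
      ≤ n.factorial / r ^ n * Real.exp r * ((y * r ^ 3 / 6) ^ m / m.factorial) := by
    intro m _
    rcases lt_or_ge n (3 * m) with h | h
    · rw [packings_eq_empty h]
      simp only [Finset.card_empty, Nat.cast_zero, zero_mul]
      positivity
    · have he := Real.pow_div_factorial_le_exp r hr.le (n - 3 * m)
      have hpow : r ^ n = r ^ (n - 3 * m) * (r ^ 3) ^ m := by
        rw [← pow_mul, ← pow_add, Nat.sub_add_cancel h]
      calc ((packings n m).card : ℝ) * y ^ m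
          = n.factorial / r ^ n * (r ^ (n - 3 * m) / (n - 3 * m).factorial)
              * ((y * r ^ 3 / 6) ^ m / m.factorial) := by
            rw [card_packings_eq h, hpow, div_pow, mul_pow]
            field_simp
        _ ≤ _ := by gcongr
  refine (Finset.sum_le_sum hterm).trans ?_
  rw [← Finset.mul_sum, Real.exp_add, ← mul_assoc]
  exact mul_le_mul_of_nonneg_left (Real.sum_le_exp_of_nonneg hx _) (by positivity)

/-! ### The triangles of a graph -/

/-- The vertex sets of the triangles of `G`. -/
def triangleSet (G : SimpleGraph (Fin n)) : Finset (Finset (Fin n)) :=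
  (triples n).filter fun t => (pairs t : Set (Sym2 (Fin n))) ⊆ G.edgeSet

lemma mem_triangleSet {G : SimpleGraph (Fin n)} {t : Finset (Fin n)} :
    t ∈ triangleSet G ↔ t.card = 3 ∧ (pairs t : Set (Sym2 (Fin n))) ⊆ G.edgeSet := by
  rw [triangleSet, Finset.mem_filter, mem_triples]

lemma triangleVertexCount_eq (G : SimpleGraph (Fin n)) :
    triangleVertexCount G = (covered (triangleSet G)).card := by
  rw [triangleVertexCount, ← Set.ncard_coe_finset]
  congr 1
  ext v
  simp only [Set.mem_ofPred_eq, Finset.mem_coe, mem_covered]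
  constructor
  · rintro ⟨u, w, hvu, hvw, huw⟩
    refine ⟨{v, u, w}, mem_triangleSet.2
      ⟨Finset.card_eq_three.2 ⟨v, u, w, hvu.ne, hvw.ne, huw.ne, rfl⟩, ?_⟩, by simp⟩
    intro e
    induction e with | _ a b =>
    intro h
    obtain ⟨ha, hb, hab⟩ := mem_pairs.1 (Finset.mem_coe.1 h)
    simp only [Finset.mem_insert, Finset.mem_singleton] at ha hb
    rw [SimpleGraph.mem_edgeSet]
    have := hvu.symm
    have := hvw.symm
    have := huw.symm
    rcases ha with rfl | rfl | rfl <;> rcases hb with rfl | rfl | rfl <;>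
      first | assumption | exact absurd rfl hab
  · rintro ⟨t, ht, hv⟩
    obtain ⟨h3, hsub⟩ := mem_triangleSet.1 ht
    obtain ⟨a, b, hab, hE⟩ := Finset.card_eq_two.1
      (show (t.erase v).card = 2 by rw [Finset.card_erase_of_mem hv, h3])
    have ha : a ∈ t.erase v := by rw [hE]; simp
    have hb : b ∈ t.erase v := by rw [hE]; simp
    rw [Finset.mem_erase] at ha hb
    refine ⟨a, b, ?_, ?_, ?_⟩
    · exact hsub (Finset.mem_coe.2 (mem_pairs.2 ⟨hv, ha.2, ha.1.symm⟩))
    · exact hsub (Finset.mem_coe.2 (mem_pairs.2 ⟨hv, hb.2, hb.1.symm⟩))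
    · exact hsub (Finset.mem_coe.2 (mem_pairs.2 ⟨ha.2, hb.2, hab⟩))

lemma famEdges_subset_edgeSet {G : SimpleGraph (Fin n)} {P : Finset (Finset (Fin n))}
    (hP : P ⊆ triangleSet G) : (famEdges P : Set (Sym2 (Fin n))) ⊆ G.edgeSet := by
  intro e he
  obtain ⟨t, ht, het⟩ := mem_famEdges.1 (Finset.mem_coe.1 he)
  exact (mem_triangleSet.1 (hP ht)).2 (Finset.mem_coe.2 het)

/-! ### Vertices attached to the edges of a family -/

/-- The pairs joining `v` to the two ends of `e`. -/
def star (v : Fin n) (e : Sym2 (Fin n)) : Finset (Sym2 (Fin n)) :=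
  e.toFinset.image fun a => s(v, a)

lemma mem_of_mem_star {v : Fin n} {e f : Sym2 (Fin n)} (h : f ∈ star v e) : v ∈ f := by
  obtain ⟨a, _, rfl⟩ := Finset.mem_image.1 h
  exact Sym2.mem_mk_left v a

lemma star_subset {v : Fin n} {e : Sym2 (Fin n)} (hv : v ∉ e) :
    star v e ⊆ pairs Finset.univ := by
  intro f hf
  obtain ⟨a, ha, rfl⟩ := Finset.mem_image.1 hf
  refine mem_pairs.2 ⟨Finset.mem_univ _, Finset.mem_univ _, ?_⟩
  rintro rfl
  exact hv (Sym2.mem_toFinset.1 ha)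

lemma card_star {v : Fin n} {e : Sym2 (Fin n)} (he : ¬ e.IsDiag) : (star v e).card = 2 := by
  rw [star, Finset.card_image_of_injective _ fun a b h => Sym2.congr_right.1 h,
    Sym2.card_toFinset_of_not_isDiag e he]

/-- The factor counting the ways to attach each vertex of `W` to at most one edge of `E`, with
weight `w` for each vertex that is attached. -/
def attach (w : ℝ) (E : Finset (Sym2 (Fin n))) (W : Finset (Fin n)) (G : SimpleGraph (Fin n)) : ℝ :=
  ∏ v ∈ W, (1 + w * ∑ e ∈ E, present (star v e) G)

/-- Attachments of different vertices use different edges, so they are independent. -/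
lemma graphExp_present_mul_attach (p w : ℝ) {E : Finset (Sym2 (Fin n))}
    (hE : ∀ e ∈ E, ¬ e.IsDiag) (W : Finset (Fin n)) (hEW : ∀ v ∈ W, ∀ e ∈ E, v ∉ e) :
    ∀ B : Finset (Sym2 (Fin n)), B ⊆ pairs Finset.univ → (∀ v ∈ W, ∀ e ∈ B, v ∉ e) →
      graphExp p (fun G => present B G * attach w E W G)
        = p ^ B.card * (1 + E.card * (w * p ^ 2)) ^ W.card := by
  induction W using Finset.induction_on with
  | empty =>
    intro B hB _
    simpa [attach] using graphExp_present p hB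
  | insert v W hv ih =>
    intro B hB hBW
    have ih' := ih fun u hu => hEW u (Finset.mem_insert_of_mem hu)
    have hsplit : ∀ G, present B G * attach w E (insert v W) G
        = present B G * attach w E W G
          + w * ∑ e ∈ E, present (B ∪ star v e) G * attach w E W G := by
      intro G
      rw [attach, Finset.prod_insert hv]
      simp only [← present_mul_present]
      rw [← Finset.sum_mul, ← Finset.mul_sum]
      simp only [attach]
      ring
    have hstar : ∀ e ∈ E, graphExp p (fun G => present (B ∪ star v e) G * attach w E W G)
        = p ^ B.card * p ^ 2 * (1 + E.card * (w * p ^ 2)) ^ W.card := by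
      intro e he
      have hve := hEW v (Finset.mem_insert_self v W) e he
      have hdisj : Disjoint B (star v e) := Finset.disjoint_left.2 fun f hf hfs =>
        hBW v (Finset.mem_insert_self v W) f hf (mem_of_mem_star hfs)
      rw [ih', Finset.card_union_of_disjoint hdisj, card_star (hE e he), pow_add]
      · exact Finset.union_subset hB (star_subset hve)
      · intro u hu f hf
        rcases Finset.mem_union.1 hf with h | h
        · exact hBW u (Finset.mem_insert_of_mem hu) f h
        · obtain ⟨a, ha, rfl⟩ := Finset.mem_image.1 h
          intro huf
          rcases Sym2.mem_iff.1 huf with rfl | rfl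
          · exact hv hu
          · exact hEW u (Finset.mem_insert_of_mem hu) e he (Sym2.mem_toFinset.1 ha)
    simp only [hsplit]
    rw [graphExp_add, graphExp_const_mul, graphExp_sum, Finset.sum_congr rfl hstar,
      Finset.sum_const, nsmul_eq_mul, ih' B hB fun u hu => hBW u (Finset.mem_insert_of_mem hu),
      Finset.card_insert_of_notMem hv, pow_succ]
    ring

lemma attach_nonneg {w : ℝ} (hw : 0 ≤ w) (E : Finset (Sym2 (Fin n))) (W : Finset (Fin n))
    (G : SimpleGraph (Fin n)) : 0 ≤ attach w E W G :=
  Finset.prod_nonneg fun _ _ => add_nonneg zero_le_one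
    (mul_nonneg hw (Finset.sum_nonneg fun _ _ => present_nonneg _ G))

/-! ### The upper bound for the partition function -/

/-- The families `D` of triangles outside `C` such that `C ∪ D` is a family of edge-disjoint
triangles. -/
def extensions (C : Finset (Finset (Fin n))) : Finset (Finset (Finset (Fin n))) :=
  (triples n).powerset.filter fun D =>
    Disjoint C D ∧ ((C ∪ D : Finset (Finset (Fin n))) : Set (Finset (Fin n))).PairwiseDisjoint pairs

/-- Every graph contains a family `C` of vertex-disjoint triangles, and a family `D` of further
triangles edge-disjoint from each other and from `C`, such that each triangle in `D` has at most
two vertices outside `C`, and every other vertex in a triangle is joined to both ends of an edge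
of `C ∪ D`: take `C` maximal, and then `C ∪ D` maximal. -/
lemma exists_triangle_cover (G : SimpleGraph (Fin n)) :
    ∃ C D : Finset (Finset (Fin n)), C ∈ packings n C.card ∧ D ∈ extensions C ∧
      C ∪ D ⊆ triangleSet G ∧ (covered (C ∪ D)).card ≤ 3 * C.card + 2 * D.card ∧
      ∀ v ∈ covered (triangleSet G), v ∉ covered (C ∪ D) →
        ∃ e ∈ famEdges (C ∪ D), (star v e : Set (Sym2 (Fin n))) ⊆ G.edgeSet := by
  set T := triangleSet G with hT
  have hT3 : T ⊆ triples n := Finset.filter_subset _ _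
  obtain ⟨C, hC⟩ := Finset.exists_maximal
    (s := T.powerset.filter fun C : Finset (Finset (Fin n)) =>
      (C : Set (Finset (Fin n))).PairwiseDisjoint id)
    ⟨∅, by simp⟩
  have hCmem := hC.prop
  rw [Finset.mem_filter, Finset.mem_powerset] at hCmem
  obtain ⟨hCT, hCd⟩ := hCmem
  obtain ⟨P, hCP, hP⟩ := Finset.exists_le_maximal
    (T.powerset.filter fun P : Finset (Finset (Fin n)) =>
      (P : Set (Finset (Fin n))).PairwiseDisjoint pairs)
    (a := C) (Finset.mem_filter.2 ⟨Finset.mem_powerset.2 hCT,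
      fun t ht u hu htu => disjoint_pairs_of_disjoint (hCd ht hu htu)⟩)
  have hPmem := hP.prop
  rw [Finset.mem_filter, Finset.mem_powerset] at hPmem
  obtain ⟨hPT, hPd⟩ := hPmem
  have hU : C ∪ (P \ C) = P := Finset.union_sdiff_of_subset hCP
  have hCpack : C ∈ packings n C.card := mem_packings.2 ⟨hCT.trans hT3, rfl, hCd⟩
  refine ⟨C, P \ C, hCpack, ?_, ?_, ?_, ?_⟩
  · refine Finset.mem_filter.2 ⟨Finset.mem_powerset.2
      ((Finset.sdiff_subset.trans hPT).trans hT3), Finset.disjoint_sdiff, ?_⟩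
    rw [hU]
    exact hPd
  · rw [hU]
    exact hPT
  · have hsub : covered (C ∪ (P \ C)) ⊆ covered C ∪ (P \ C).biUnion fun t => t \ covered C := by
      intro v hv
      obtain ⟨t, ht, hvt⟩ := mem_covered.1 hv
      by_cases hvC : v ∈ covered C
      · exact Finset.mem_union_left _ hvC
      · rcases Finset.mem_union.1 ht with h | h
        · exact absurd (mem_covered.2 ⟨t, h, hvt⟩) hvC
        · exact Finset.mem_union_right _
            (Finset.mem_biUnion.2 ⟨t, h, Finset.mem_sdiff.2 ⟨hvt, hvC⟩⟩)
    refine (Finset.card_le_card hsub).trans ((Finset.card_union_le _ _).trans ?_)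
    rw [card_covered_of_mem_packings hCpack, mul_comm 2]
    refine Nat.add_le_add_left (Finset.card_biUnion_le_card_mul _ _ _ fun t ht => ?_) _
    obtain ⟨htP, htC⟩ := Finset.mem_sdiff.1 ht
    have ht3 := mem_triples.1 (hT3 (hPT htP))
    -- By maximality of `C`, the triangle `t` has a vertex in common with `C`.
    have hmeet : ∃ v ∈ t, v ∈ covered C := by
      by_contra! hno
      have hins : insert t C ∈
          T.powerset.filter fun C : Finset (Finset (Fin n)) =>
      (C : Set (Finset (Fin n))).PairwiseDisjoint id := by
        refine Finset.mem_filter.2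
          ⟨Finset.mem_powerset.2 (Finset.insert_subset (hPT htP) hCT), ?_⟩
        rw [Finset.coe_insert]
        refine hCd.insert fun u hu _ => Finset.disjoint_left.2 fun v hv hvu => ?_
        exact hno v hv (mem_covered.2 ⟨u, hu, hvu⟩)
      exact htC (hC.le_of_ge hins (Finset.subset_insert t C) (Finset.mem_insert_self t C))
    obtain ⟨v, hvt, hvC⟩ := hmeet
    have : (t \ covered C).card < t.card := Finset.card_lt_card
      ⟨Finset.sdiff_subset, fun h => (Finset.mem_sdiff.1 (h hvt)).2 hvC⟩
    omega
  · rw [hU]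
    intro v hv hvP
    obtain ⟨t, htT, hvt⟩ := mem_covered.1 hv
    have htP : t ∉ P := fun h => hvP (mem_covered.2 ⟨t, h, hvt⟩)
    -- By maximality of `P`, the triangle `t` has an edge in common with `P`.
    have hmeet : ∃ u ∈ P, ¬ Disjoint (pairs t) (pairs u) := by
      by_contra! hno
      have hins : insert t P ∈
          T.powerset.filter fun P : Finset (Finset (Fin n)) =>
      (P : Set (Finset (Fin n))).PairwiseDisjoint pairs := by
        refine Finset.mem_filter.2
          ⟨Finset.mem_powerset.2 (Finset.insert_subset htT hPT), ?_⟩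
        rw [Finset.coe_insert]
        exact hPd.insert fun u hu _ => hno u hu
      exact htP (hP.le_of_ge hins (Finset.subset_insert t P) (Finset.mem_insert_self t P))
    obtain ⟨u, hu, htu⟩ := hmeet
    obtain ⟨e, het, heu⟩ := Finset.not_disjoint_iff.1 htu
    refine ⟨e, mem_famEdges.2 ⟨u, hu, heu⟩, ?_⟩
    intro f hf
    refine (mem_triangleSet.1 htT).2 (Finset.mem_coe.2 ?_)
    obtain ⟨a, ha, rfl⟩ := Finset.mem_image.1 (Finset.mem_coe.1 hf)
    have hae := Sym2.mem_toFinset.1 ha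
    have hmem : ∀ {s : Finset (Fin n)}, e ∈ pairs s → a ∈ s := by
      intro s hs
      induction e with | _ b c =>
      have := mem_pairs.1 hs
      rcases Sym2.mem_iff.1 hae with rfl | rfl
      · exact this.1
      · exact this.2.1
    refine mem_pairs.2 ⟨hvt, hmem het, ?_⟩
    rintro rfl
    exact hvP (mem_covered.2 ⟨u, hu, hmem heu⟩)

/-- The contribution of the families `C` and `D` to the union bound for `w ^ V_T(G)`. -/
def coverTerm (w : ℝ) (C D : Finset (Finset (Fin n))) (G : SimpleGraph (Fin n)) : ℝ :=
  w ^ (3 * C.card + 2 * D.card) *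
    (present (famEdges (C ∪ D)) G * attach w (famEdges (C ∪ D)) (covered (C ∪ D))ᶜ G)

lemma coverTerm_nonneg {w : ℝ} (hw : 0 ≤ w) (C D : Finset (Finset (Fin n)))
    (G : SimpleGraph (Fin n)) : 0 ≤ coverTerm w C D G :=
  mul_nonneg (pow_nonneg hw _) (mul_nonneg (present_nonneg _ G) (attach_nonneg hw _ _ G))

lemma pow_triangleVertexCount_le {w : ℝ} (hw : 1 ≤ w) (G : SimpleGraph (Fin n)) :
    w ^ triangleVertexCount G
      ≤ ∑ m ∈ Finset.range (n + 1), ∑ C ∈ packings n m, ∑ D ∈ extensions C, coverTerm w C D G := by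
  have hw0 : 0 ≤ w := zero_le_one.trans hw
  obtain ⟨C, D, hC, hD, hsub, hcov, hatt⟩ := exists_triangle_cover G
  have hm : C.card ∈ Finset.range (n + 1) := by
    have h1 := card_covered_of_mem_packings hC
    have h2 := Finset.card_le_univ (covered C)
    rw [Fintype.card_fin] at h2
    rw [Finset.mem_range]
    omega
  have hterm : w ^ triangleVertexCount G ≤ coverTerm w C D G := by
    set P := C ∪ D with hP
    set R := covered (triangleSet G) \ covered P with hR
    have hcard : triangleVertexCount G ≤ 3 * C.card + 2 * D.card + R.card := by
      rw [triangleVertexCount_eq]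
      have h1 : covered (triangleSet G) ⊆ covered P ∪ R := by
        rw [hR, Finset.union_sdiff_self_eq_union]
        exact Finset.subset_union_right
      have h2 := (Finset.card_le_card h1).trans (Finset.card_union_le _ _)
      omega
    have hpres : present (famEdges P) G = 1 := if_pos (famEdges_subset_edgeSet hsub)
    have hRsub : R ⊆ (covered P)ᶜ := fun v hv =>
      Finset.mem_compl.2 (Finset.mem_sdiff.1 hv).2
    have hprod : w ^ R.card ≤ attach w (famEdges P) (covered P)ᶜ G := by
      have h1 : w ^ R.card = ∏ v ∈ (covered P)ᶜ, (if v ∈ R then w else 1) := by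
        rw [Finset.prod_ite, Finset.prod_const, Finset.prod_const_one, mul_one,
          Finset.filter_mem_eq_inter, Finset.inter_eq_right.2 hRsub]
      rw [h1, attach]
      refine Finset.prod_le_prod (fun v _ => by split_ifs <;> linarith) fun v _ => ?_
      have hsum : 0 ≤ ∑ e ∈ famEdges P, present (star v e) G :=
        Finset.sum_nonneg fun e _ => present_nonneg _ G
      split_ifs with hv
      · obtain ⟨hvT, hvP⟩ := Finset.mem_sdiff.1 hv
        obtain ⟨e, he, hstar⟩ := hatt v hvT hvP
        have h1 : 1 ≤ ∑ e ∈ famEdges P, present (star v e) G := by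
          have h := Finset.single_le_sum (f := fun e => present (star v e) G)
            (fun e _ => present_nonneg _ G) he
          have h' : present (star v e) G = 1 := if_pos hstar
          simpa only [h'] using h
        nlinarith
      · nlinarith
    calc w ^ triangleVertexCount G ≤ w ^ (3 * C.card + 2 * D.card + R.card) :=
          pow_le_pow_right₀ hw hcard
      _ = w ^ (3 * C.card + 2 * D.card) * w ^ R.card := pow_add _ _ _
      _ ≤ coverTerm w C D G := by
          rw [coverTerm, ← hP, hpres, one_mul]
          exact mul_le_mul_of_nonneg_left hprod (pow_nonneg hw0 _)
  refine hterm.trans ?_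
  calc coverTerm w C D G ≤ ∑ D ∈ extensions C, coverTerm w C D G :=
        Finset.single_le_sum (f := fun D => coverTerm w C D G)
          (fun D _ => coverTerm_nonneg hw0 C D G) hD
    _ ≤ ∑ C ∈ packings n C.card, ∑ D ∈ extensions C, coverTerm w C D G :=
        Finset.single_le_sum (f := fun C => ∑ D ∈ extensions C, coverTerm w C D G)
          (fun C _ => Finset.sum_nonneg fun D _ => coverTerm_nonneg hw0 C D G) hC
    _ ≤ _ := Finset.single_le_sum
          (f := fun m => ∑ C ∈ packings n m, ∑ D ∈ extensions C, coverTerm w C D G)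
          (fun m _ => Finset.sum_nonneg fun C _ =>
            Finset.sum_nonneg fun D _ => coverTerm_nonneg hw0 C D G) hm

lemma graphExp_coverTerm_le {p w : ℝ} (hp0 : 0 ≤ p) (hw : 0 ≤ w) {m : ℕ}
    {C D : Finset (Finset (Fin n))} (hC : C ∈ packings n m) (hD : D ∈ extensions C) :
    graphExp p (coverTerm w C D)
      ≤ (w ^ 3 * p ^ 3 * Real.exp (3 * n * (w * p ^ 2))) ^ m
        * (w ^ 2 * p ^ 3 * Real.exp (3 * n * (w * p ^ 2))) ^ D.card := by
  obtain ⟨hC3, hCm, -⟩ := mem_packings.1 hC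
  obtain ⟨hD3, hdisj, hPd⟩ := Finset.mem_filter.1 hD
  have hP3 : C ∪ D ⊆ triples n := Finset.union_subset hC3 (Finset.mem_powerset.1 hD3)
  have hcard : (famEdges (C ∪ D)).card = 3 * (m + D.card) := by
    rw [card_famEdges hP3 hPd, Finset.card_union_of_disjoint hdisj, hCm]
  have hnot : ∀ v ∈ (covered (C ∪ D))ᶜ, ∀ e ∈ famEdges (C ∪ D), v ∉ e := by
    intro v hv e he hve
    obtain ⟨t, ht, het⟩ := mem_famEdges.1 he
    refine Finset.mem_compl.1 hv (mem_covered.2 ⟨t, ht, ?_⟩)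
    induction e with | _ a b =>
    have := mem_pairs.1 het
    rcases Sym2.mem_iff.1 hve with rfl | rfl
    · exact this.1
    · exact this.2.1
  have hle : (covered (C ∪ D))ᶜ.card ≤ n := by
    simpa using Finset.card_le_univ (covered (C ∪ D))ᶜ
  unfold coverTerm
  rw [graphExp_const_mul, graphExp_present_mul_attach p w
    (fun e he => not_isDiag_of_mem_pairs (famEdges_subset _ he)) _ hnot _ (famEdges_subset _) hnot,
    hcard, hCm]
  have hx : 0 ≤ ((3 * (m + D.card) : ℕ) : ℝ) * (w * p ^ 2) := by positivity
  have hpow : (1 + ((3 * (m + D.card) : ℕ) : ℝ) * (w * p ^ 2)) ^ (covered (C ∪ D))ᶜ.card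
      ≤ Real.exp (3 * n * (w * p ^ 2)) ^ (m + D.card) := by
    calc _ ≤ (1 + ((3 * (m + D.card) : ℕ) : ℝ) * (w * p ^ 2)) ^ n :=
          pow_le_pow_right₀ (by linarith) hle
      _ ≤ Real.exp (((3 * (m + D.card) : ℕ) : ℝ) * (w * p ^ 2)) ^ n := by
          refine pow_le_pow_left₀ (by linarith) ?_ n
          rw [add_comm]
          exact Real.add_one_le_exp _
      _ = _ := by
          rw [← Real.exp_nat_mul, ← Real.exp_nat_mul]
          congr 1
          push_cast
          ring
  calc _ ≤ w ^ (3 * m + 2 * D.card) * (p ^ (3 * (m + D.card))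
        * Real.exp (3 * n * (w * p ^ 2)) ^ (m + D.card)) := by gcongr
    _ = _ := by
        rw [mul_pow, mul_pow, mul_pow, mul_pow]
        ring

/-- Upper bound for the partition function. The families of triangles that overlap the
vertex-disjoint ones only contribute the first factor, which is subexponential at criticality. -/
lemma graphExp_pow_triangleVertexCount_le {p w : ℝ} (hp0 : 0 ≤ p) (hp1 : p ≤ 1) (hw : 1 ≤ w) :
    graphExp p (fun G : SimpleGraph (Fin n) => w ^ triangleVertexCount G)
      ≤ Real.exp (n ^ 3 * (w ^ 2 * p ^ 3 * Real.exp (3 * n * (w * p ^ 2))))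
        * ∑ m ∈ Finset.range (n + 1), ((packings n m).card : ℝ)
          * (w ^ 3 * p ^ 3 * Real.exp (3 * n * (w * p ^ 2))) ^ m := by
  have hw0 : 0 ≤ w := zero_le_one.trans hw
  set x := w ^ 2 * p ^ 3 * Real.exp (3 * n * (w * p ^ 2)) with hx
  set y := w ^ 3 * p ^ 3 * Real.exp (3 * n * (w * p ^ 2)) with hy
  have hx0 : 0 ≤ x := by positivity
  have hy0 : 0 ≤ y := by positivity
  have hD : ∀ C : Finset (Finset (Fin n)),
      ∑ D ∈ extensions C, x ^ D.card ≤ Real.exp (n ^ 3 * x) := by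
    intro C
    calc ∑ D ∈ extensions C, x ^ D.card ≤ ∑ D ∈ (triples n).powerset, x ^ D.card :=
          Finset.sum_le_sum_of_subset_of_nonneg (Finset.filter_subset _ _)
            fun D _ _ => pow_nonneg hx0 _
      _ = ∏ _t ∈ triples n, (1 + x) := by
          rw [Finset.prod_one_add]
          exact Finset.sum_congr rfl fun D _ => (Finset.prod_const x).symm
      _ = (1 + x) ^ n.choose 3 := by rw [Finset.prod_const, card_triples]
      _ ≤ (1 + x) ^ (n ^ 3) := pow_le_pow_right₀ (by linarith) (Nat.choose_le_pow n 3)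
      _ ≤ Real.exp x ^ (n ^ 3) := by
          refine pow_le_pow_left₀ (by linarith) ?_ _
          rw [add_comm]
          exact Real.add_one_le_exp x
      _ = Real.exp (n ^ 3 * x) := by
          rw [← Real.exp_nat_mul]
          push_cast
          rfl
  refine (graphExp_mono hp0 hp1 (pow_triangleVertexCount_le hw)).trans ?_
  rw [graphExp_sum, Finset.mul_sum]
  refine Finset.sum_le_sum fun m _ => ?_
  rw [graphExp_sum]
  have hC : ∀ C ∈ packings n m,
      graphExp p (fun G => ∑ D ∈ extensions C, coverTerm w C D G)
        ≤ Real.exp (n ^ 3 * x) * y ^ m := by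
    intro C hC
    rw [graphExp_sum]
    calc ∑ D ∈ extensions C, graphExp p (coverTerm w C D)
        ≤ ∑ D ∈ extensions C, y ^ m * x ^ D.card :=
          Finset.sum_le_sum fun D hD => graphExp_coverTerm_le hp0 hw0 hC hD
      _ = y ^ m * ∑ D ∈ extensions C, x ^ D.card := (Finset.mul_sum _ _ _).symm
      _ ≤ y ^ m * Real.exp (n ^ 3 * x) := mul_le_mul_of_nonneg_left (hD C) (pow_nonneg hy0 m)
      _ = _ := mul_comm _ _
  refine (Finset.sum_le_sum hC).trans (le_of_eq ?_)
  rw [Finset.sum_const, nsmul_eq_mul]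
  ring

/-! ### The lower bound for the partition function -/

/-- A triangle outside a family of vertex-disjoint triangles shares at most one edge with it. -/
lemma card_pairs_inter_famEdges_le {m : ℕ} {C : Finset (Finset (Fin n))} (hC : C ∈ packings n m)
    {t : Finset (Fin n)} (ht : t.card = 3) (htC : t ∉ C) :
    (pairs t ∩ famEdges C).card ≤ 1 := by
  obtain ⟨h3, -, hd⟩ := mem_packings.1 hC
  have hmeet : ∀ {e u}, e ∈ pairs t → e ∈ pairs u → e ∈ pairs (t ∩ u) := by
    intro e u
    induction e with | _ a b =>
    simp only [mem_pairs, Finset.mem_inter]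
    tauto
  rw [Finset.card_le_one]
  intro e he f hf
  obtain ⟨het, heC⟩ := Finset.mem_inter.1 he
  obtain ⟨hft, hfC⟩ := Finset.mem_inter.1 hf
  obtain ⟨u, hu, heu⟩ := mem_famEdges.1 heC
  obtain ⟨u', hu', hfu⟩ := mem_famEdges.1 hfC
  have huu : u = u' := by
    by_contra hne
    have hdisj : Disjoint (t ∩ u) (t ∩ u') :=
      (hd hu hu' hne).mono Finset.inter_subset_right Finset.inter_subset_right
    have h2 : ∀ {e u}, e ∈ pairs t → e ∈ pairs u → 2 ≤ (t ∩ u).card := by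
      intro e u h h'
      have h1 : 0 < (pairs (t ∩ u)).card := Finset.card_pos.2 ⟨e, hmeet h h'⟩
      rw [card_pairs] at h1
      by_contra hlt
      rw [Nat.choose_eq_zero_of_lt (by omega)] at h1
      exact lt_irrefl _ h1
    have hle := Finset.card_le_card
      (Finset.union_subset (Finset.inter_subset_left (s₁ := t) (s₂ := u))
        (Finset.inter_subset_left (s₁ := t) (s₂ := u')))
    rw [Finset.card_union_of_disjoint hdisj] at hle
    have h4 := h2 het heu
    have h5 := h2 hft hfu
    omega
  subst huu
  have hlt : (t ∩ u).card ≤ 2 := by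
    by_contra hgt
    have hu3 := mem_triples.1 (h3 hu)
    have h1 : t ∩ u = t := Finset.eq_of_subset_of_card_le Finset.inter_subset_left (by omega)
    have h2 : t ∩ u = u := Finset.eq_of_subset_of_card_le Finset.inter_subset_right (by omega)
    exact htC ((h1.symm.trans h2) ▸ hu)
  have h1 : (pairs (t ∩ u)).card ≤ 1 := by
    rw [card_pairs]
    exact (Nat.choose_le_choose 2 hlt).trans (by simp)
  exact Finset.card_le_one.1 h1 e (hmeet het heu) f (hmeet hft hfu)

lemma card_triples_containing_le (e : Sym2 (Fin n)) :
    ((triples n).filter fun t => e ∈ pairs t).card ≤ n := by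
  induction e with | _ a b =>
  have hsub : ((triples n).filter fun t => s(a, b) ∈ pairs t)
      ⊆ Finset.univ.image fun c : Fin n => ({a, b, c} : Finset (Fin n)) := by
    intro t ht
    obtain ⟨ht3, hab⟩ := Finset.mem_filter.1 ht
    obtain ⟨ha, hb, hne⟩ := mem_pairs.1 hab
    have ht3 := mem_triples.1 ht3
    obtain ⟨c, hc⟩ := Finset.card_eq_one.1 (show ((t.erase a).erase b).card = 1 by
      rw [Finset.card_erase_of_mem (Finset.mem_erase.2 ⟨hne.symm, hb⟩),
        Finset.card_erase_of_mem ha, ht3])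
    refine Finset.mem_image.2 ⟨c, Finset.mem_univ _, ?_⟩
    rw [show ({a, b, c} : Finset (Fin n)) = insert a (insert b {c}) from rfl, ← hc,
      Finset.insert_erase (Finset.mem_erase.2 ⟨hne.symm, hb⟩), Finset.insert_erase ha]
  refine (Finset.card_le_card hsub).trans (Finset.card_image_le.trans ?_)
  simp

/-- Given the triangles in `C`, the expected number of further triangles is bounded at edge
probability of order `1 / n`. -/
lemma sum_graphExp_present_union_le {p : ℝ} (hp0 : 0 ≤ p) (hp1 : p ≤ 1) {m : ℕ}
    {C : Finset (Finset (Fin n))} (hC : C ∈ packings n m) :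
    ∑ t ∈ triples n \ C, graphExp p (present (famEdges C ∪ pairs t))
      ≤ p ^ (3 * m) * (n ^ 3 * p ^ 3 + 3 * m * n * p ^ 2) := by
  have hterm : ∀ t ∈ triples n \ C, graphExp p (present (famEdges C ∪ pairs t))
      ≤ p ^ (3 * m) * (p ^ 3 + ∑ e ∈ famEdges C, if e ∈ pairs t then p ^ 2 else 0) := by
    intro t ht
    obtain ⟨ht3, htC⟩ := Finset.mem_sdiff.1 ht
    have ht3 := mem_triples.1 ht3
    have hle := card_pairs_inter_famEdges_le hC ht3 htC
    have hp2 : ∀ e ∈ famEdges C, 0 ≤ if e ∈ pairs t then p ^ 2 else 0 := fun e _ => by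
      split_ifs <;> positivity
    rw [graphExp_present p (Finset.union_subset (famEdges_subset C)
      (pairs_mono (Finset.subset_univ t))), ← Finset.union_sdiff_self_eq_union,
      Finset.card_union_of_disjoint Finset.disjoint_sdiff, card_famEdges_of_mem_packings hC,
      pow_add]
    refine mul_le_mul_of_nonneg_left ?_ (pow_nonneg hp0 _)
    have hcard := Finset.card_sdiff_add_card_inter (pairs t) (famEdges C)
    have hc3 : (pairs t).card = 3 := by rw [card_pairs, ht3]; rfl
    rcases (pairs t ∩ famEdges C).eq_empty_or_nonempty with h | ⟨e, he⟩
    · rw [h, Finset.card_empty, hc3] at hcard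
      rw [show (pairs t \ famEdges C).card = 3 by omega]
      linarith [Finset.sum_nonneg hp2]
    · obtain ⟨het, heC⟩ := Finset.mem_inter.1 he
      have h1 := Finset.single_le_sum (f := fun e => if e ∈ pairs t then p ^ 2 else 0) hp2 heC
      simp only [if_pos het] at h1
      have h2 : p ^ (pairs t \ famEdges C).card ≤ p ^ 2 :=
        pow_le_pow_of_le_one hp0 hp1 (by omega)
      have h3 := pow_nonneg hp0 3
      linarith
  refine (Finset.sum_le_sum hterm).trans ?_
  rw [← Finset.mul_sum]
  refine mul_le_mul_of_nonneg_left ?_ (pow_nonneg hp0 _)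
  have hcount : ∀ e ∈ famEdges C,
      ∑ t ∈ triples n, (if e ∈ pairs t then p ^ 2 else 0) ≤ n * p ^ 2 := by
    intro e _
    rw [← Finset.sum_filter, Finset.sum_const, nsmul_eq_mul]
    exact mul_le_mul_of_nonneg_right (by exact_mod_cast card_triples_containing_le e)
      (pow_nonneg hp0 2)
  calc _ ≤ ∑ t ∈ triples n, (p ^ 3 + ∑ e ∈ famEdges C, if e ∈ pairs t then p ^ 2 else 0) := by
        refine Finset.sum_le_sum_of_subset_of_nonneg Finset.sdiff_subset fun t _ _ => ?_
        refine add_nonneg (pow_nonneg hp0 3) (Finset.sum_nonneg fun e _ => ?_)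
        split_ifs <;> positivity
    _ = n.choose 3 * p ^ 3 + ∑ e ∈ famEdges C, ∑ t ∈ triples n,
          (if e ∈ pairs t then p ^ 2 else 0) := by
        rw [Finset.sum_add_distrib, Finset.sum_const, card_triples, nsmul_eq_mul, Finset.sum_comm]
    _ ≤ n ^ 3 * p ^ 3 + ∑ _e ∈ famEdges C, n * p ^ 2 := by
        refine add_le_add ?_ (Finset.sum_le_sum hcount)
        exact mul_le_mul_of_nonneg_right (by exact_mod_cast Nat.choose_le_pow n 3)
          (pow_nonneg hp0 3)
    _ = _ := by
        rw [Finset.sum_const, card_famEdges_of_mem_packings hC, nsmul_eq_mul]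
        push_cast
        ring

lemma famEdges_subset_edgeSet_iff {G : SimpleGraph (Fin n)} {C : Finset (Finset (Fin n))}
    (hC : C ⊆ triples n) :
    (famEdges C : Set (Sym2 (Fin n))) ⊆ G.edgeSet ↔ C ⊆ triangleSet G := by
  refine ⟨fun h t ht => mem_triangleSet.2 ⟨mem_triples.1 (hC ht), fun e he => ?_⟩,
    famEdges_subset_edgeSet⟩
  exact h (Finset.mem_coe.2 (mem_famEdges.2 ⟨t, ht, Finset.mem_coe.1 he⟩))

/-- Markov's inequality for the number of triangles of `G` outside `C`, in pointwise form. -/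
lemma present_mul_one_sub_le {K m : ℕ} (hK : 0 < K) {C : Finset (Finset (Fin n))}
    (hC : C ∈ packings n m) (G : SimpleGraph (Fin n)) :
    present (famEdges C) G - (K : ℝ)⁻¹ * ∑ t ∈ triples n \ C, present (famEdges C ∪ pairs t) G
      ≤ if C ⊆ triangleSet G ∧ (triangleSet G).card ≤ m + K then 1 else 0 := by
  obtain ⟨h3, hm, -⟩ := mem_packings.1 hC
  have hK' : (0 : ℝ) < K := by exact_mod_cast hK
  simp only [← present_mul_present]
  rw [← Finset.mul_sum]
  by_cases hsub : C ⊆ triangleSet G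
  · have h1 : present (famEdges C) G = 1 := if_pos ((famEdges_subset_edgeSet_iff h3).2 hsub)
    have h2 : ∑ t ∈ triples n \ C, present (pairs t) G = ((triangleSet G).card : ℝ) - m := by
      have : (triples n \ C).filter (fun t => (pairs t : Set (Sym2 (Fin n))) ⊆ G.edgeSet)
          = triangleSet G \ C := by
        ext t
        simp only [Finset.mem_filter, Finset.mem_sdiff, mem_triples, mem_triangleSet]
        tauto
      simp only [present]
      rw [← Finset.sum_filter, this, Finset.sum_const, nsmul_eq_mul, mul_one,
        Finset.card_sdiff_of_subset hsub, Nat.cast_sub (Finset.card_le_card hsub), hm]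
    rw [h1, h2, one_mul]
    have hT : (m : ℝ) ≤ (triangleSet G).card := by
      exact_mod_cast hm ▸ Finset.card_le_card hsub
    split_ifs with h
    · have : 0 ≤ (K : ℝ)⁻¹ * ((triangleSet G).card - m) := by
        have := sub_nonneg.2 hT
        positivity
      linarith
    · have hgt : m + K ≤ (triangleSet G).card := by
        by_contra hlt
        exact h ⟨hsub, by omega⟩
      have hgt' : (m : ℝ) + K ≤ (triangleSet G).card := by exact_mod_cast hgt
      have : (K : ℝ)⁻¹ * K ≤ (K : ℝ)⁻¹ * ((triangleSet G).card - m) :=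
        mul_le_mul_of_nonneg_left (by linarith) (by positivity)
      rw [inv_mul_cancel₀ hK'.ne'] at this
      linarith
  · have h1 : present (famEdges C) G = 0 :=
      if_neg fun h => hsub ((famEdges_subset_edgeSet_iff h3).1 h)
    rw [h1, if_neg fun h => hsub h.1]
    simp

lemma sum_packings_indicator_le {w : ℝ} (hw : 1 ≤ w) (K m : ℕ) (G : SimpleGraph (Fin n)) :
    w ^ (3 * m) * ∑ C ∈ packings n m,
        (if C ⊆ triangleSet G ∧ (triangleSet G).card ≤ m + K then (1 : ℝ) else 0)
      ≤ ((m + K : ℕ) : ℝ) ^ K * w ^ triangleVertexCount G := by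
  have hw0 : 0 ≤ w := zero_le_one.trans hw
  rw [← Finset.sum_filter, Finset.sum_const, nsmul_eq_mul, mul_one]
  rcases ((packings n m).filter fun C =>
    C ⊆ triangleSet G ∧ (triangleSet G).card ≤ m + K).eq_empty_or_nonempty with h | ⟨C, hC⟩
  · rw [h, Finset.card_empty, Nat.cast_zero, mul_zero]
    positivity
  · obtain ⟨hCp, hCT, hT⟩ := Finset.mem_filter.1 hC
    have hV : 3 * m ≤ triangleVertexCount G := by
      rw [triangleVertexCount_eq, ← card_covered_of_mem_packings hCp]
      exact Finset.card_le_card (Finset.biUnion_subset_biUnion_of_subset_left _ hCT)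
    have hcard : ((packings n m).filter fun C =>
        C ⊆ triangleSet G ∧ (triangleSet G).card ≤ m + K).card ≤ (m + K) ^ K := by
      have hsub : ((packings n m).filter fun C =>
          C ⊆ triangleSet G ∧ (triangleSet G).card ≤ m + K)
          ⊆ (triangleSet G).powersetCard m := by
        intro D hD
        obtain ⟨hDp, hDT, -⟩ := Finset.mem_filter.1 hD
        exact Finset.mem_powersetCard.2 ⟨hDT, (mem_packings.1 hDp).2.1⟩
      refine (Finset.card_le_card hsub).trans ?_
      rw [Finset.card_powersetCard]
      refine (Nat.choose_le_choose m hT).trans ?_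
      rw [Nat.choose_symm_add]
      exact Nat.choose_le_pow _ _
    rw [mul_comm]
    exact mul_le_mul (by exact_mod_cast hcard) (pow_le_pow_right₀ hw hV) (pow_nonneg hw0 _)
      (by positivity)

/-- Lower bound for the partition function, from the graphs that contain `m` vertex-disjoint
triangles and at most `K` further triangles. Such a graph contains at most `(m + K) ^ K` families
of `m` triangles. -/
lemma le_graphExp_pow_triangleVertexCount {p w : ℝ} (hp0 : 0 ≤ p) (hp1 : p ≤ 1) (hw : 1 ≤ w)
    {K : ℕ} (hK : 0 < K) (m : ℕ) :
    (packings n m).card * (w ^ 3 * p ^ 3) ^ m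
        * (1 - (K : ℝ)⁻¹ * (n ^ 3 * p ^ 3 + 3 * m * n * p ^ 2))
      ≤ ((m + K : ℕ) : ℝ) ^ K
        * graphExp p (fun G : SimpleGraph (Fin n) => w ^ triangleVertexCount G) := by
  have hw0 : 0 ≤ w := zero_le_one.trans hw
  have hterm : ∀ C ∈ packings n m,
      p ^ (3 * m) * (1 - (K : ℝ)⁻¹ * (n ^ 3 * p ^ 3 + 3 * m * n * p ^ 2))
        ≤ graphExp p (fun G => if C ⊆ triangleSet G ∧ (triangleSet G).card ≤ m + K
            then (1 : ℝ) else 0) := by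
    intro C hC
    refine le_trans ?_ (graphExp_mono hp0 hp1 (present_mul_one_sub_le hK hC))
    rw [graphExp_sub, graphExp_const_mul, graphExp_sum, graphExp_present p (famEdges_subset C),
      card_famEdges_of_mem_packings hC]
    have h := mul_le_mul_of_nonneg_left (sum_graphExp_present_union_le hp0 hp1 hC)
      (inv_nonneg.2 (Nat.cast_nonneg (α := ℝ) K))
    linarith
  have hsum := Finset.sum_le_sum hterm
  rw [Finset.sum_const, nsmul_eq_mul, ← graphExp_sum] at hsum
  have h1 := mul_le_mul_of_nonneg_left hsum (pow_nonneg hw0 (3 * m))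
  rw [← graphExp_const_mul] at h1
  have h2 := graphExp_mono hp0 hp1 (sum_packings_indicator_le (n := n) hw K m)
  rw [graphExp_const_mul p (((m + K : ℕ) : ℝ) ^ K)] at h2
  refine le_trans (le_of_eq ?_) (h1.trans h2)
  rw [mul_pow, ← pow_mul, ← pow_mul]
  ring

end FiniteGraphs

/-! ### The variational problem -/

lemma exists_density (c : ℝ) :
    ∃ a ∈ Set.Ioo (0 : ℝ) 1, (1 - a) ^ 3 * Real.exp (3 * c) = 2 * a := by
  have hcont : ContinuousOn (fun a : ℝ => 2 * a - (1 - a) ^ 3 * Real.exp (3 * c))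
      (Set.Icc 0 1) := by fun_prop
  have h := intermediate_value_Ioo zero_le_one hcont
  have h0 : (0 : ℝ) ∈ Set.Ioo (2 * 0 - (1 - 0) ^ 3 * Real.exp (3 * c))
      (2 * 1 - (1 - 1) ^ 3 * Real.exp (3 * c)) := by
    have := Real.exp_pos (3 * c)
    constructor <;> norm_num
    exact this
  obtain ⟨a, ha, hz⟩ := h h0
  exact ⟨a, ha, by linarith [show 2 * a - (1 - a) ^ 3 * Real.exp (3 * c) = 0 from hz]⟩

/-- The maximizer of `rate a θ lam` over `a ∈ [0, 1]`, as a function of `c = θ + log lam`: the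
root in `(0, 1)` of the equation `(1 - a) ^ 3 * exp (3 * c) = 2 * a`. -/
def density (c : ℝ) : ℝ := (exists_density c).choose

/-- The maximum of `rate a θ lam` over `a ∈ [0, 1]`, as a function of `c = θ + log lam`. -/
def pressure (c : ℝ) : ℝ := -Real.log (1 - density c) - 2 / 3 * density c

lemma density_mem (c : ℝ) : density c ∈ Set.Ioo (0 : ℝ) 1 := (exists_density c).choose_spec.1

lemma density_eq (c : ℝ) : (1 - density c) ^ 3 * Real.exp (3 * c) = 2 * density c :=
  (exists_density c).choose_spec.2

lemma density_lt_of_lt {a a' c c' : ℝ} (ha : a ∈ Set.Ioo (0 : ℝ) 1)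
    (h : (1 - a) ^ 3 * Real.exp (3 * c) = 2 * a)
    (h' : (1 - a') ^ 3 * Real.exp (3 * c') = 2 * a') (hc : c < c') : a < a' := by
  by_contra! hle
  have h1 : (1 - a) ^ 3 ≤ (1 - a') ^ 3 :=
    pow_le_pow_left₀ (sub_nonneg.2 ha.2.le) (by linarith) 3
  have h2 : Real.exp (3 * c) < Real.exp (3 * c') := Real.exp_lt_exp.2 (by linarith)
  have h3 : 0 < (1 - a) ^ 3 := pow_pos (sub_pos.2 ha.2) 3
  have h4 : (1 - a) ^ 3 * Real.exp (3 * c) < (1 - a') ^ 3 * Real.exp (3 * c') :=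
    mul_lt_mul' h1 h2 (Real.exp_pos _).le (h3.trans_le h1)
  linarith

lemma density_strictMono : StrictMono density := fun c c' hc =>
  density_lt_of_lt (density_mem c) (density_eq c) (density_eq c') hc

lemma range_density : Set.range density = Set.Ioo 0 1 := by
  refine Set.Subset.antisymm (Set.range_subset_iff.2 density_mem) fun a ha => ?_
  have h1 : 0 < 2 * a := by linarith [ha.1]
  have h2 : 0 < 1 - a := sub_pos.2 ha.2
  refine ⟨Real.log (2 * a / (1 - a) ^ 3) / 3, ?_⟩
  set c := Real.log (2 * a / (1 - a) ^ 3) / 3 with hc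
  have h : (1 - a) ^ 3 * Real.exp (3 * c) = 2 * a := by
    rw [hc, mul_div_cancel₀ _ (by norm_num), Real.exp_log (by positivity)]
    field_simp
  -- The left side of the equation decreases in `a` and the right side increases.
  have hle : ∀ {a a' : ℝ}, a ∈ Set.Ioo (0 : ℝ) 1 → (1 - a) ^ 3 * Real.exp (3 * c) = 2 * a →
      (1 - a') ^ 3 * Real.exp (3 * c) = 2 * a' → a ≤ a' := by
    intro a a' ha h h'
    by_contra! hlt
    have h1 : (1 - a) ^ 3 ≤ (1 - a') ^ 3 :=
      pow_le_pow_left₀ (sub_nonneg.2 ha.2.le) (by linarith) 3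
    have := mul_le_mul_of_nonneg_right h1 (Real.exp_pos (3 * c)).le
    linarith
  exact le_antisymm (hle (density_mem c) (density_eq c) h) (hle ha h (density_eq c))

lemma continuous_density : Continuous density := by
  rw [continuous_iff_continuousAt]
  intro c
  refine continuousAt_of_monotoneOn_of_image_mem_nhds (s := Set.univ)
    (density_strictMono.monotone.monotoneOn _) Filter.univ_mem ?_
  rw [Set.image_univ, range_density]
  exact Ioo_mem_nhds (density_mem c).1 (density_mem c).2

lemma log_density_eq (c : ℝ) :
    c + Real.log (1 - density c) = 1 / 3 * Real.log (2 * density c) := by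
  have h1 : 0 < 1 - density c := sub_pos.2 (density_mem c).2
  rw [← density_eq c, Real.log_mul (pow_pos h1 3).ne' (Real.exp_pos _).ne', Real.log_pow,
    Real.log_exp]
  push_cast
  ring

/-- The tangent line inequality for `x * log x` at `y`. -/
lemma mul_log_add_sub_lt {x y : ℝ} (hx : 0 ≤ x) (hy : 0 < y) (hxy : x ≠ y) :
    x * Real.log y + x - y < x * Real.log x := by
  rcases hx.eq_or_lt with rfl | hx
  · simpa using hy
  · have h := Real.log_lt_sub_one_of_pos (div_pos hy hx) fun h =>
      hxy ((div_eq_one_iff_eq hx.ne').1 h).symm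
    rw [Real.log_div hy.ne' hx.ne'] at h
    have h' := mul_lt_mul_of_pos_left h hx
    have : x * (y / x - 1) = y - x := by field_simp
    linarith

lemma rate_density (θ lam : ℝ) :
    rate (density (θ + Real.log lam)) θ lam = pressure (θ + Real.log lam) := by
  have h := log_density_eq (θ + Real.log lam)
  unfold rate pressure
  set a := density (θ + Real.log lam) with ha
  have h0 : 0 < a := (density_mem _).1
  have h6 : Real.log (1 / 3 * a) + Real.log 6 = Real.log (2 * a) := by
    rw [← Real.log_mul (by positivity) (by norm_num)]
    congr 1
    ring
  have h7 : Real.log (1 / 3 * a) = 3 * (θ + Real.log lam + Real.log (1 - a)) - Real.log 6 := by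
    linarith
  rw [h7]
  ring

/-- `density (θ + log lam)` is the only maximizer: compare both entropy terms with their tangent
lines there, where the derivative of the rate vanishes. -/
lemma rate_lt_pressure {a θ lam : ℝ} (ha : a ∈ Set.Icc (0 : ℝ) 1)
    (hne : a ≠ density (θ + Real.log lam)) : rate a θ lam < pressure (θ + Real.log lam) := by
  have h := log_density_eq (θ + Real.log lam)
  unfold rate pressure
  set b := density (θ + Real.log lam) with hb
  have hb0 : 0 < b := (density_mem _).1
  have hb1 : 0 < 1 - b := sub_pos.2 (density_mem _).2
  have h1 := mul_log_add_sub_lt (sub_nonneg.2 ha.2) hb1 fun h => hne (by linarith)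
  have h2 := mul_log_add_sub_lt (x := 1 / 3 * a) (y := 1 / 3 * b) (by linarith [ha.1])
    (by linarith) fun h => hne (by linarith)
  have h6 : Real.log (1 / 3 * b) + Real.log 6 = Real.log (2 * b) := by
    rw [← Real.log_mul (by positivity) (by norm_num)]
    congr 1
    ring
  have h7 : Real.log (1 / 3 * b) = 3 * (θ + Real.log lam + Real.log (1 - b)) - Real.log 6 := by
    linarith
  rw [h7] at h2
  nlinarith [h1, h2]

lemma pressure_tangent_le (c c' : ℝ) : pressure c + density c * (c' - c) ≤ pressure c' := by
  have h1 := rate_density c 1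
  have h2 : rate (density c) c' 1 ≤ pressure c' := by
    by_cases h : density c = density c'
    · rw [h]
      simpa using (rate_density c' 1).le
    · simpa using (rate_lt_pressure (θ := c') (lam := 1)
        ⟨(density_mem c).1.le, (density_mem c).2.le⟩ (by simpa using h)).le
  simp only [Real.log_one, add_zero] at h1
  unfold rate at h1 h2
  linarith

lemma hasDerivAt_pressure (c : ℝ) : HasDerivAt pressure (density c) c := by
  rw [hasDerivAt_iff_isLittleO, Asymptotics.isLittleO_iff]
  intro ε hε
  filter_upwards [Metric.continuousAt_iff'.1 continuous_density.continuousAt ε hε] with x hx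
  rw [Real.dist_eq] at hx
  have h1 := pressure_tangent_le c x
  have h2 := pressure_tangent_le x c
  rw [Real.norm_eq_abs, Real.norm_eq_abs, smul_eq_mul, abs_of_nonneg (by linarith)]
  calc pressure x - pressure c - (x - c) * density c ≤ (density x - density c) * (x - c) := by
        linarith
    _ ≤ |density x - density c| * |x - c| := by rw [← abs_mul]; exact le_abs_self _
    _ ≤ ε * |x - c| := mul_le_mul_of_nonneg_right hx.le (abs_nonneg _)

/-! ### Factorials on the exponential scale -/

lemma tendsto_log_factorial_div :
    Tendsto (fun n : ℕ => Real.log n.factorial / n - Real.log n) atTop (𝓝 (-1)) := by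
  have h1 : Tendsto (fun n : ℕ => Real.log (Stirling.stirlingSeq n)) atTop
      (𝓝 (Real.log (Real.sqrt Real.pi))) :=
    Stirling.tendsto_stirlingSeq_sqrt_pi.log (by positivity)
  have hn : Tendsto (fun n : ℕ => (n : ℝ)⁻¹) atTop (𝓝 0) := tendsto_inv_atTop_nhds_zero_nat
  have hlog : Tendsto (fun n : ℕ => Real.log (2 * n) * (n : ℝ)⁻¹) atTop (𝓝 0) := by
    have h := (Real.isLittleO_log_id_atTop.tendsto_div_nhds_zero).comp
      ((tendsto_natCast_atTop_atTop (R := ℝ)).const_mul_atTop (show (0 : ℝ) < 2 by norm_num))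
    have h2 := h.const_mul 2
    rw [mul_zero] at h2
    refine h2.congr fun n => ?_
    simp only [Function.comp, id]
    rw [div_eq_mul_inv, mul_inv]
    ring
  have h := ((h1.mul hn).add (hlog.const_mul (1 / 2))).sub_const 1
  rw [mul_zero, mul_zero, zero_add, zero_sub] at h
  refine h.congr' ?_
  filter_upwards [eventually_gt_atTop 0] with n hpos
  have hn0 : (n : ℝ) ≠ 0 := by exact_mod_cast hpos.ne'
  rw [Stirling.log_stirlingSeq_formula, Real.log_div hn0 (Real.exp_pos 1).ne', Real.log_exp]
  field_simp
  ring

/-- If `k n / n → x > 0`, then `log (k n)! = k n * log n + (x * log x - x) * n + o(n)`. -/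
lemma tendsto_log_factorial_scaled {k : ℕ → ℕ} {x : ℝ} (hx : 0 < x)
    (hk : Tendsto (fun n => (k n : ℝ) / n) atTop (𝓝 x)) :
    Tendsto (fun n : ℕ => Real.log (k n).factorial / n - (k n : ℝ) / n * Real.log n) atTop
      (𝓝 (x * Real.log x - x)) := by
  have hkt : Tendsto k atTop atTop := by
    rw [← tendsto_natCast_atTop_iff (R := ℝ)]
    refine (hk.pos_mul_atTop hx (tendsto_natCast_atTop_atTop (R := ℝ))).congr' ?_
    filter_upwards [eventually_gt_atTop 0] with n hn
    have hn0 : (n : ℝ) ≠ 0 := by exact_mod_cast hn.ne'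
    field_simp
  have h := (hk.mul (tendsto_log_factorial_div.comp hkt)).add (hk.mul (hk.log hx.ne'))
  rw [show x * -1 + x * Real.log x = x * Real.log x - x by ring] at h
  refine h.congr' ?_
  filter_upwards [eventually_gt_atTop 0, hkt.eventually_gt_atTop 0] with n hn hkn
  have hn0 : (n : ℝ) ≠ 0 := by exact_mod_cast hn.ne'
  have hk0 : (k n : ℝ) ≠ 0 := by exact_mod_cast hkn.ne'
  simp only [Function.comp]
  rw [Real.log_div hk0 hn0]
  field_simp
  ring

/-! ### The free energy at criticality -/

/-- The weight of a vertex in a triangle at criticality. It equals `n ^ (1 / 3) * exp θ` for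
`n ≥ 2`. -/
def criticalWeight (θ : ℝ) (n : ℕ) : ℝ := Real.exp (criticalBeta θ n * Real.log n)

lemma criticalWeight_pos (θ : ℝ) (n : ℕ) : 0 < criticalWeight θ n := Real.exp_pos _

lemma criticalWeight_eq (θ : ℝ) {n : ℕ} (hn : 1 < n) :
    criticalWeight θ n = Real.exp (1 / 3 * Real.log n + θ) := by
  have : Real.log n ≠ 0 := (Real.log_pos (by exact_mod_cast hn)).ne'
  rw [criticalWeight, criticalBeta]
  congr 1
  field_simp

lemma log_criticalWeight (θ : ℝ) {n : ℕ} (hn : 1 < n) :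
    Real.log (criticalWeight θ n) = 1 / 3 * Real.log n + θ := by
  rw [criticalWeight_eq θ hn, Real.log_exp]

lemma criticalWeight_pow_three (θ : ℝ) {n : ℕ} (hn : 1 < n) :
    criticalWeight θ n ^ 3 = n * Real.exp (3 * θ) := by
  have hn0 : (0 : ℝ) < n := by exact_mod_cast (by omega : 0 < n)
  rw [criticalWeight_eq θ hn, ← Real.exp_nat_mul]
  nth_rewrite 2 [← Real.exp_log hn0]
  rw [← Real.exp_add]
  congr 1
  push_cast
  ring

lemma tendsto_log_natCast : Tendsto (fun n : ℕ => Real.log n) atTop atTop :=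
  Real.tendsto_log_atTop.comp tendsto_natCast_atTop_atTop

lemma one_le_criticalWeight (θ : ℝ) : ∀ᶠ n : ℕ in atTop, 1 ≤ criticalWeight θ n := by
  filter_upwards [eventually_gt_atTop 1, tendsto_log_natCast.eventually_ge_atTop (-(3 * θ))]
    with n hn hlog
  rw [criticalWeight_eq θ hn]
  exact Real.one_le_exp (by linarith)

lemma tendsto_criticalWeight_sq_div (θ : ℝ) :
    Tendsto (fun n : ℕ => criticalWeight θ n ^ 2 / n) atTop (𝓝 0) := by
  have h : Tendsto (fun n : ℕ => 2 * θ - 1 / 3 * Real.log n) atTop atBot := by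
    simp only [sub_eq_add_neg]
    exact tendsto_atBot_add_const_left _ _ (tendsto_neg_atTop_atBot.comp
      (tendsto_log_natCast.const_mul_atTop (by norm_num)))
  refine (Real.tendsto_exp_atBot.comp h).congr' ?_
  filter_upwards [eventually_gt_atTop 1] with n hn
  have hn0 : (0 : ℝ) < n := by exact_mod_cast (by omega : 0 < n)
  rw [criticalWeight_eq θ hn, ← Real.exp_nat_mul]
  nth_rewrite 2 [← Real.exp_log hn0]
  rw [← Real.exp_sub, Function.comp]
  congr 1
  push_cast
  ring

lemma tendsto_criticalWeight_div (θ : ℝ) :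
    Tendsto (fun n : ℕ => criticalWeight θ n / n) atTop (𝓝 0) := by
  refine tendsto_of_tendsto_of_tendsto_of_le_of_le' tendsto_const_nhds
    (tendsto_criticalWeight_sq_div θ) (Eventually.of_forall fun n => ?_) ?_
  · exact div_nonneg (criticalWeight_pos θ n).le (Nat.cast_nonneg n)
  · filter_upwards [one_le_criticalWeight θ] with n hn
    exact div_le_div_of_nonneg_right (le_self_pow₀ hn two_ne_zero) (Nat.cast_nonneg n)

/-- The partition function of the weight `w ^ V_T(G)`. -/
def countExp (p w : ℝ) (n : ℕ) : ℝ :=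
  graphExp p fun G : SimpleGraph (Fin n) => w ^ triangleVertexCount G

lemma one_le_countExp {p w : ℝ} {n : ℕ} (hp0 : 0 ≤ p) (hp1 : p ≤ 1) (hw : 1 ≤ w) :
    1 ≤ countExp p w n := by
  have h := graphExp_present (n := n) p (A := ∅) (Finset.empty_subset _)
  rw [Finset.card_empty, pow_zero] at h
  rw [← h]
  refine graphExp_mono hp0 hp1 fun G => ?_
  rw [present, if_pos (by simp)]
  exact one_le_pow₀ hw

lemma log_countExp_upper {p : ℕ → ℝ} {lam : ℝ} (θ : ℝ) (hlam : 0 < lam)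
    (hp0 : ∀ n, 0 ≤ p n) (hp1 : ∀ n, p n ≤ 1)
    (hp : Tendsto (fun n : ℕ => n * p n) atTop (𝓝 lam)) :
    ∃ u : ℕ → ℝ, Tendsto u atTop (𝓝 (pressure (θ + Real.log lam))) ∧
      ∀ᶠ n : ℕ in atTop, 1 / (n : ℝ) * Real.log (countExp (p n) (criticalWeight θ n) n) ≤ u n := by
  set a := density (θ + Real.log lam) with ha
  -- `ρ * n` is the saddle point of the generating function of the triangle families.
  set ρ := 1 - a with hρ
  have hρ0 : 0 < ρ := sub_pos.2 (density_mem _).2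
  set s : ℕ → ℝ := fun n => Real.exp (3 * n * (criticalWeight θ n * p n ^ 2)) with hs
  have hs1 : Tendsto s atTop (𝓝 1) := by
    have h := (((hp.pow 2).mul (tendsto_criticalWeight_div θ)).const_mul 3).rexp
    rw [mul_zero, mul_zero, Real.exp_zero] at h
    refine h.congr' ?_
    filter_upwards [eventually_gt_atTop 0] with n hn
    have hn0 : (n : ℝ) ≠ 0 := by exact_mod_cast hn.ne'
    simp only [hs]
    congr 1
    field_simp
  have hA : Tendsto (fun n : ℕ => (n * p n) ^ 3 * (criticalWeight θ n ^ 2 / n) * s n)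
      atTop (𝓝 0) := by
    simpa using ((hp.pow 3).mul (tendsto_criticalWeight_sq_div θ)).mul hs1
  have hB : Tendsto (fun n : ℕ => ρ + Real.exp (3 * θ) * (n * p n) ^ 3 * s n * ρ ^ 3 / 6)
      atTop (𝓝 (ρ + Real.exp (3 * θ) * lam ^ 3 * 1 * ρ ^ 3 / 6)) :=
    (((((hp.pow 3).const_mul _).mul hs1).mul_const _).div_const _).const_add _
  have hF := tendsto_log_factorial_div.sub_const (Real.log ρ)
  refine ⟨fun n => (n * p n) ^ 3 * (criticalWeight θ n ^ 2 / n) * s n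
      + (Real.log n.factorial / n - Real.log n - Real.log ρ)
      + (ρ + Real.exp (3 * θ) * (n * p n) ^ 3 * s n * ρ ^ 3 / 6), ?_, ?_⟩
  · have h := (hA.add hF).add hB
    convert h using 2
    have hexp : Real.exp (3 * θ) * lam ^ 3 = Real.exp (3 * (θ + Real.log lam)) := by
      nth_rewrite 1 [← Real.exp_log hlam]
      rw [← Real.exp_nat_mul, ← Real.exp_add]
      congr 1
      push_cast
      ring
    have heq := density_eq (θ + Real.log lam)
    rw [← ha, ← hρ] at heq
    rw [hexp, mul_one, mul_comm (Real.exp _), heq, pressure, ← ha, ← hρ, hρ]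
    ring
  · filter_upwards [eventually_gt_atTop 1, one_le_criticalWeight θ] with n hn hw
    have hn0 : (0 : ℝ) < n := by exact_mod_cast (by omega : 0 < n)
    set w := criticalWeight θ n with hwdef
    have hw3 := criticalWeight_pow_three θ hn
    rw [← hwdef] at hw3
    have hr : 0 < ρ * n := mul_pos hρ0 hn0
    have hy : 0 ≤ w ^ 3 * p n ^ 3 * s n :=
      mul_nonneg (mul_nonneg (pow_nonneg (by linarith) _) (pow_nonneg (hp0 n) _))
        (Real.exp_pos _).le
    have h1 := (graphExp_pow_triangleVertexCount_le (n := n) (hp0 n) (hp1 n) hw).trans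
      (mul_le_mul_of_nonneg_left (sum_card_packings_le hy hr) (Real.exp_pos _).le)
    have hfac : (0 : ℝ) < n.factorial := by exact_mod_cast n.factorial_pos
    have h2 := Real.log_le_log (zero_lt_one.trans_le (one_le_countExp (hp0 n) (hp1 n) hw)) h1
    rw [Real.log_mul (Real.exp_pos _).ne' (by positivity), Real.log_exp,
      Real.log_mul (by positivity) (Real.exp_pos _).ne', Real.log_exp,
      Real.log_div hfac.ne' (by positivity), Real.log_pow, Real.log_mul hρ0.ne' hn0.ne', hw3] at h2
    have h3 := mul_le_mul_of_nonneg_left h2 (one_div_pos.2 hn0).le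
    refine h3.trans (le_of_eq ?_)
    have hsn : Real.exp (3 * n * (w * p n ^ 2)) = s n := rfl
    rw [hsn]
    field_simp
    ring

lemma log_countExp_lower {p : ℕ → ℝ} {lam : ℝ} (θ : ℝ) (hlam : 0 < lam)
    (hp0 : ∀ n, 0 ≤ p n) (hp1 : ∀ n, p n ≤ 1)
    (hp : Tendsto (fun n : ℕ => n * p n) atTop (𝓝 lam)) :
    ∃ l : ℕ → ℝ, Tendsto l atTop (𝓝 (pressure (θ + Real.log lam))) ∧
      ∀ᶠ n : ℕ in atTop, l n ≤ 1 / (n : ℝ) * Real.log (countExp (p n) (criticalWeight θ n) n) := by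
  set a := density (θ + Real.log lam) with ha
  have ha0 : 0 < a := (density_mem _).1
  have ha1 : a < 1 := (density_mem _).2
  have hcast := tendsto_natCast_atTop_atTop (R := ℝ)
  -- `m n` is the optimal number of disjoint triangles.
  set m : ℕ → ℕ := fun n => ⌊a / 3 * n⌋₊ with hm
  have hmn : Tendsto (fun n : ℕ => (m n : ℝ) / n) atTop (𝓝 (a / 3)) :=
    (tendsto_nat_floor_mul_div_atTop (by positivity : 0 ≤ a / 3)).comp hcast
  have hmle : ∀ n, 3 * m n ≤ n := by
    intro n
    have h1 := Nat.floor_le (by positivity : 0 ≤ a / 3 * n)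
    have h2 : a * n ≤ n := mul_le_of_le_one_left (Nat.cast_nonneg n) ha1.le
    have h3 : (3 * m n : ℝ) ≤ n := by simp only [hm]; linarith
    exact_mod_cast h3
  have hkn : Tendsto (fun n : ℕ => ((n - 3 * m n : ℕ) : ℝ) / n) atTop (𝓝 (1 - a)) := by
    have h := (hmn.const_mul 3).const_sub 1
    rw [show 1 - 3 * (a / 3) = 1 - a by ring] at h
    refine h.congr' ?_
    filter_upwards [eventually_gt_atTop 0] with n hn
    have hn0 : (n : ℝ) ≠ 0 := by exact_mod_cast hn.ne'
    rw [Nat.cast_sub (hmle n)]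
    push_cast
    field_simp
  obtain ⟨K, hK⟩ := exists_nat_ge (2 * (lam ^ 3 + lam ^ 2 + 1))
  have hK0' : (0 : ℝ) < K := lt_of_lt_of_le (by positivity) hK
  have hK0 : 0 < K := by exact_mod_cast hK0'
  have hlogK : Tendsto (fun n : ℕ => K * (Real.log ((m n + K : ℕ) : ℝ) / n)) atTop (𝓝 0) := by
    have h0 : Tendsto (fun n : ℕ => ((m n + K : ℕ) : ℝ) / n) atTop (𝓝 (a / 3)) := by
      have h := hmn.add (tendsto_const_div_atTop_nhds_zero_nat (K : ℝ))
      rw [add_zero] at h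
      refine h.congr fun n => ?_
      push_cast
      ring
    have h1 : Tendsto (fun n : ℕ => ((m n + K : ℕ) : ℝ)) atTop atTop := by
      refine (h0.pos_mul_atTop (by positivity) hcast).congr' ?_
      filter_upwards [eventually_gt_atTop 0] with n hn
      have hn0 : (n : ℝ) ≠ 0 := by exact_mod_cast hn.ne'
      field_simp
    have h2 := (((Real.isLittleO_log_id_atTop.tendsto_div_nhds_zero).comp h1).mul h0).const_mul
      (K : ℝ)
    rw [zero_mul, mul_zero] at h2
    refine h2.congr' (Eventually.of_forall fun n => ?_)
    have : ((m n + K : ℕ) : ℝ) ≠ 0 := by exact_mod_cast (by omega : m n + K ≠ 0)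
    simp only [Function.comp, id]
    field_simp
  have hF1 := tendsto_log_factorial_div
  have hF2 := tendsto_log_factorial_scaled (by positivity) hmn
  have hF3 := tendsto_log_factorial_scaled (sub_pos.2 ha1) hkn
  have hlogp := hmn.mul ((hp.log hlam.ne').const_mul 3 |>.const_add (3 * θ))
  have hlog2 := tendsto_const_div_atTop_nhds_zero_nat (Real.log 2)
  have hlim := ((((hF1.sub hF2).sub (hmn.mul_const (Real.log 6))).sub hF3).add hlogp).sub
    (hlog2.add hlogK)
  have hval : -1 - (a / 3 * Real.log (a / 3) - a / 3) - a / 3 * Real.log 6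
      - ((1 - a) * Real.log (1 - a) - (1 - a)) + a / 3 * (3 * θ + 3 * Real.log lam) - (0 + 0)
      = pressure (θ + Real.log lam) := by
    rw [← rate_density, ← ha, rate, show (1 : ℝ) / 3 * a = a / 3 by ring]
    ring
  rw [hval] at hlim
  refine ⟨_, hlim, ?_⟩
  have hbound := ((hp.pow 3).add (hp.pow 2)).eventually (gt_mem_nhds (lt_add_one _))
  filter_upwards [eventually_gt_atTop 1, one_le_criticalWeight θ, hbound,
    hp.eventually (lt_mem_nhds hlam)] with n hn hw hb hnp
  have hn0 : (0 : ℝ) < n := by exact_mod_cast (by omega : 0 < n)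
  have hpn : 0 < p n := pos_of_mul_pos_right hnp hn0.le
  set w := criticalWeight θ n with hwdef
  have hw0 : 0 < w := by linarith
  have hZ := zero_lt_one.trans_le (one_le_countExp (n := n) (hp0 n) (hp1 n) hw)
  have h1 := le_graphExp_pow_triangleVertexCount (n := n) (hp0 n) (hp1 n) hw hK0 (m n)
  have hN : (0 : ℝ) < (packings n (m n)).card := by
    rw [card_packings_eq (hmle n)]
    positivity
  have hhalf : (2 : ℝ)⁻¹
      ≤ 1 - (K : ℝ)⁻¹ * (n ^ 3 * p n ^ 3 + 3 * m n * n * p n ^ 2) := by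
    have hm3 : (3 * m n : ℝ) ≤ n := by exact_mod_cast hmle n
    have h3 : 3 * m n * n * p n ^ 2 ≤ (n * p n) ^ 2 := by
      rw [mul_pow, sq (n : ℝ)]
      gcongr
    have h4 : (n : ℝ) ^ 3 * p n ^ 3 + 3 * m n * n * p n ^ 2 ≤ K / 2 := by
      rw [← mul_pow]
      linarith
    have h5 := mul_le_mul_of_nonneg_left h4 (inv_pos.2 hK0').le
    have h6 : (K : ℝ)⁻¹ * (K / 2) = 2⁻¹ := by field_simp
    linarith
  have h2 := (mul_le_mul_of_nonneg_left hhalf (by positivity)).trans h1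
  have hmK : (0 : ℝ) < ((m n + K : ℕ) : ℝ) := by exact_mod_cast (by omega : 0 < m n + K)
  have h3 := Real.log_le_log (by positivity) h2
  have hfac : ∀ k : ℕ, (k.factorial : ℝ) ≠ 0 := fun k => by exact_mod_cast k.factorial_ne_zero
  have h6 : ((6 : ℝ) ^ m n) ≠ 0 := by positivity
  change _ ≤ Real.log (_ * countExp (p n) w n) at h3
  rw [Real.log_mul (by positivity) (by positivity), Real.log_mul hN.ne' (by positivity),
    card_packings_eq (hmle n), Real.log_div (hfac _) (by positivity),
    Real.log_mul (mul_ne_zero (hfac _) h6) (hfac _), Real.log_mul (hfac _) h6, Real.log_pow,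
    Real.log_pow, Real.log_inv, Real.log_mul (by positivity) (by positivity), Real.log_pow,
    Real.log_pow, log_criticalWeight θ hn, Real.log_mul (by positivity) hZ.ne',
    Real.log_pow] at h3
  have h4 := mul_le_mul_of_nonneg_left (sub_le_iff_le_add'.2 h3) (one_div_pos.2 hn0).le
  refine le_trans (le_of_eq ?_) h4
  rw [Nat.cast_sub (hmle n), Real.log_mul hn0.ne' hpn.ne']
  push_cast
  field_simp
  ring

/-- The free energy at criticality, for edge probabilities asymptotic to `lam / n`. -/
theorem tendsto_log_countExp {p : ℕ → ℝ} {lam : ℝ} (θ : ℝ) (hlam : 0 < lam)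
    (hp0 : ∀ n, 0 ≤ p n) (hp1 : ∀ n, p n ≤ 1)
    (hp : Tendsto (fun n : ℕ => n * p n) atTop (𝓝 lam)) :
    Tendsto (fun n : ℕ => 1 / (n : ℝ) * Real.log (countExp (p n) (criticalWeight θ n) n)) atTop
      (𝓝 (pressure (θ + Real.log lam))) := by
  obtain ⟨u, hu, hu'⟩ := log_countExp_upper θ hlam hp0 hp1 hp
  obtain ⟨l, hl, hl'⟩ := log_countExp_lower θ hlam hp0 hp1 hp
  exact tendsto_of_tendsto_of_tendsto_of_le_of_le' hl hu hl' hu'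

/-! ### Concentration from the free energy -/

lemma weight_criticalBeta (θ : ℝ) (G : SimpleGraph (Fin n)) :
    weight (criticalBeta θ n) G = criticalWeight θ n ^ triangleVertexCount G := by
  rw [weight, criticalWeight, ← Real.exp_nat_mul, mul_comm]

lemma partitionFunction_criticalBeta (lam θ : ℝ) (n : ℕ) :
    partitionFunction lam (criticalBeta θ n) n
      = countExp (edgeProb lam n : ℝ) (criticalWeight θ n) n := by
  rw [partitionFunction, integral_erdosRenyi, countExp]
  exact congrArg _ (funext fun G => weight_criticalBeta θ G)

lemma edgeProb_nonneg (lam : ℝ) (n : ℕ) : (0 : ℝ) ≤ edgeProb lam n := (edgeProb lam n).2.1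

lemma edgeProb_le_one (lam : ℝ) (n : ℕ) : (edgeProb lam n : ℝ) ≤ 1 := (edgeProb lam n).2.2

lemma tendsto_mul_edgeProb {lam : ℝ} (hlam : 0 < lam) :
    Tendsto (fun n : ℕ => (n : ℝ) * edgeProb lam n) atTop (𝓝 lam) := by
  refine tendsto_const_nhds.congr' ?_
  filter_upwards [(tendsto_natCast_atTop_atTop (R := ℝ)).eventually_ge_atTop lam,
    eventually_gt_atTop 0] with n hn hpos
  have hn0 : (0 : ℝ) < n := by exact_mod_cast hpos
  rw [edgeProb, Set.coe_projIcc, min_eq_right ((div_le_one hn0).2 hn),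
    max_eq_right (div_nonneg hlam.le hn0.le), mul_div_cancel₀ _ hn0.ne']

lemma graphExp_pos {p : ℝ} (hp0 : 0 ≤ p) (hp1 : p ≤ 1) {f : SimpleGraph (Fin n) → ℝ}
    (hf : ∀ G, 0 < f G) : 0 < graphExp p f := by
  obtain ⟨G₀, -, hmin⟩ := Finset.exists_min_image Finset.univ f Finset.univ_nonempty
  have h := graphExp_present (n := n) p (A := ∅) (Finset.empty_subset _)
  rw [Finset.card_empty, pow_zero] at h
  have h1 := graphExp_mono hp0 hp1 (f := fun G => f G₀ * present ∅ G) (g := f) fun G => by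
    simpa [present] using hmin G (Finset.mem_univ G)
  rw [graphExp_const_mul, h, mul_one] at h1
  exact (hf G₀).trans_le h1

/-- Chernoff's bound: if the scaled cumulant generating functions of `f` under the exponential
random graph converge to a function `ψ` with `ψ' 0 = x`, then `f / n` converges to `x` in
probability. -/
lemma tendstoInProb_of_hasDerivAt {lam θ x : ℝ} {ψ : ℝ → ℝ} (f : ∀ n, SimpleGraph (Fin n) → ℝ)
    (hψ0 : ψ 0 = 0) (hψ : HasDerivAt ψ x 0)
    (hlim : ∀ t, Tendsto (fun n : ℕ => 1 / (n : ℝ) * (Real.log (graphExp (edgeProb lam n : ℝ)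
        fun G => Real.exp (t * f n G) * criticalWeight θ n ^ triangleVertexCount G)
        - Real.log (countExp (edgeProb lam n : ℝ) (criticalWeight θ n) n))) atTop (𝓝 (ψ t))) :
    TendstoInProb (fun n => ergm lam (criticalBeta θ n) n) (fun n G => f n G / n) x := by
  classical
  intro ε hε
  rw [hasDerivAt_iff_isLittleO, Asymptotics.isLittleO_iff] at hψ
  obtain ⟨δ, hδ, hball⟩ := Metric.eventually_nhds_iff.1 (hψ (half_pos hε))
  have hbound : ∀ t, |t| < δ → ψ t ≤ x * t + ε / 2 * |t| := by
    intro t ht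
    have h := hball (y := t) (by rwa [Real.dist_eq, sub_zero])
    rw [hψ0, sub_zero, sub_zero, smul_eq_mul, Real.norm_eq_abs, Real.norm_eq_abs] at h
    linarith [le_abs_self (ψ t - t * x)]
  set Z : ℕ → ℝ := fun n => countExp (edgeProb lam n : ℝ) (criticalWeight θ n) n with hZdef
  set M : ℝ → ℕ → ℝ := fun t n => graphExp (edgeProb lam n : ℝ)
    fun G => Real.exp (t * f n G) * criticalWeight θ n ^ triangleVertexCount G with hMdef
  have hZ : ∀ n, 0 < Z n := fun n => graphExp_pos (edgeProb_nonneg lam n) (edgeProb_le_one lam n)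
    fun G => pow_pos (criticalWeight_pos θ n) _
  have hM : ∀ t n, 0 < M t n := fun t n => graphExp_pos (edgeProb_nonneg lam n)
    (edgeProb_le_one lam n) fun G => mul_pos (Real.exp_pos _) (pow_pos (criticalWeight_pos θ n) _)
  have hdecay : ∀ t, t ≠ 0 → |t| < δ →
      Tendsto (fun n : ℕ => Real.exp (-(n * (x * t + ε * |t|))) * M t n / Z n) atTop (𝓝 0) := by
    intro t ht0 htδ
    have hneg : ψ t - (x * t + ε * |t|) < 0 := by
      have h1 := hbound t htδ
      have h2 := mul_pos (half_pos hε) (abs_pos.2 ht0)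
      linarith
    have h := ((hlim t).sub_const (x * t + ε * |t|)).neg_mul_atTop hneg
      (tendsto_natCast_atTop_atTop (R := ℝ))
    refine (Real.tendsto_exp_atBot.comp h).congr' ?_
    filter_upwards [eventually_gt_atTop 0] with n hn
    have hn0 : (n : ℝ) ≠ 0 := by exact_mod_cast hn.ne'
    have hMn := hM t n
    have hZn := hZ n
    rw [Function.comp, mul_div_assoc]
    change Real.exp ((1 / (n : ℝ) * (Real.log (M t n) - Real.log (Z n)) - _) * n) = _
    rw [← Real.exp_log (div_pos hMn hZn)]
    rw [Real.log_div hMn.ne' hZn.ne', ← Real.exp_add]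
    congr 1
    field_simp
    ring
  have hδ2 : |δ / 2| < δ := by
    rw [abs_of_pos (half_pos hδ)]
    linarith
  have hsum := (hdecay (δ / 2) (half_pos hδ).ne' hδ2).add
    (hdecay (-(δ / 2)) (neg_ne_zero.2 (half_pos hδ).ne') (by rwa [abs_neg]))
  rw [add_zero] at hsum
  have hE := ENNReal.tendsto_ofReal hsum
  rw [ENNReal.ofReal_zero] at hE
  refine tendsto_of_tendsto_of_tendsto_of_le_of_le' tendsto_const_nhds hE
    (Eventually.of_forall fun _ => zero_le) ?_
  filter_upwards [eventually_gt_atTop 0] with n hn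
  have hn0 : (0 : ℝ) < n := by exact_mod_cast hn
  rw [ergm_apply, partitionFunction_criticalBeta]
  refine ENNReal.ofReal_le_ofReal ?_
  rw [← add_div]
  refine div_le_div_of_nonneg_right ?_ (hZ n).le
  rw [hMdef, ← graphExp_const_mul, ← graphExp_const_mul, ← graphExp_add]
  refine graphExp_mono (edgeProb_nonneg lam n) (edgeProb_le_one lam n) fun G => ?_
  have hW : 0 < criticalWeight θ n ^ triangleVertexCount G := pow_pos (criticalWeight_pos θ n) _
  rw [weight_criticalBeta, ← mul_assoc, ← mul_assoc, ← add_mul, ← Real.exp_add, ← Real.exp_add,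
    abs_neg, abs_of_pos (half_pos hδ)]
  split_ifs with h
  · refine le_mul_of_one_le_left hW.le ?_
    have hf : f n G = n * (f n G / n) := (mul_div_cancel₀ _ hn0.ne').symm
    set z := f n G / n with hz
    rw [hf]
    rcases lt_abs.1 (show ε < |z - x| from h) with h1 | h1
    · refine le_add_of_le_of_nonneg (Real.one_le_exp ?_) (Real.exp_pos _).le
      have := mul_pos (mul_pos hn0 (half_pos hδ)) (sub_pos.2 h1)
      linarith
    · refine le_add_of_nonneg_of_le (Real.exp_pos _).le (Real.one_le_exp ?_)
      have := mul_pos (mul_pos hn0 (half_pos hδ)) (sub_pos.2 h1)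
      linarith
  · positivity

lemma hasDerivAt_pressure_shift (c : ℝ) :
    HasDerivAt (fun t => pressure (c + t) - pressure c) (density c) 0 := by
  have h := HasDerivAt.comp_const_add c 0 (by rw [add_zero]; exact hasDerivAt_pressure c)
  exact h.sub_const _

lemma tendstoInProb_triangleVertexCount (θ : ℝ) {lam : ℝ} (hlam : 0 < lam) :
    TendstoInProb (fun n => ergm lam (criticalBeta θ n) n)
      (fun n G => (triangleVertexCount G : ℝ) / n) (density (θ + Real.log lam)) := by
  refine tendstoInProb_of_hasDerivAt (fun n G => (triangleVertexCount G : ℝ)) ?_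
    (hasDerivAt_pressure_shift (θ + Real.log lam)) fun t => ?_
  · simp
  · have h := fun θ => tendsto_log_countExp θ hlam (edgeProb_nonneg lam) (edgeProb_le_one lam)
      (tendsto_mul_edgeProb hlam)
    have h1 := (h (θ + t)).sub (h θ)
    rw [add_right_comm θ t] at h1
    refine h1.congr' ?_
    filter_upwards [eventually_gt_atTop 1] with n hn
    rw [← mul_sub]
    congr 3
    rw [countExp]
    congr 1
    ext G
    rw [criticalWeight_eq _ hn, criticalWeight_eq _ hn, ← Real.exp_nat_mul, ← Real.exp_nat_mul,
      ← Real.exp_add]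
    congr 1
    ring

lemma tendstoInProb_edgeCount (θ : ℝ) {lam : ℝ} (hlam : 0 < lam) :
    TendstoInProb (fun n => ergm lam (criticalBeta θ n) n)
      (fun n G => (edgeCount G : ℝ) / n) (lam / 2 + density (θ + Real.log lam)) := by
  have hp := tendsto_mul_edgeProb hlam
  have hpz : Tendsto (fun n : ℕ => (edgeProb lam n : ℝ)) atTop (𝓝 0) := by
    have h := hp.mul tendsto_inv_atTop_nhds_zero_nat
    rw [mul_zero] at h
    refine h.congr' ?_
    filter_upwards [eventually_gt_atTop 0] with n hn
    have hn0 : (n : ℝ) ≠ 0 := by exact_mod_cast hn.ne'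
    field_simp
  have hder : HasDerivAt (fun t => lam * (Real.exp t - 1) / 2
      + (pressure (θ + Real.log lam + t) - pressure (θ + Real.log lam)))
      (lam / 2 + density (θ + Real.log lam)) 0 := by
    have h := ((((Real.hasDerivAt_exp 0).sub_const 1).const_mul lam).div_const 2)
    rw [Real.exp_zero, mul_one] at h
    exact h.add (hasDerivAt_pressure_shift _)
  refine tendstoInProb_of_hasDerivAt (fun n G => (edgeCount G : ℝ)) (by simp) hder fun t => ?_
  set q : ℕ → ℝ := fun n => edgeProb lam n with hq
  have hq0 : ∀ n, 0 ≤ q n := edgeProb_nonneg lam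
  have hq1 : ∀ n, q n ≤ 1 := edgeProb_le_one lam
  have hden : ∀ n, 0 < 1 - q n + q n * Real.exp t := by
    intro n
    rcases (hq0 n).eq_or_lt with h | h
    · rw [← h]; norm_num
    · have := mul_pos h (Real.exp_pos t)
      linarith [hq1 n]
  have htilt : Tendsto (fun n : ℕ => n * (q n * Real.exp t / (1 - q n + q n * Real.exp t))) atTop
      (𝓝 (lam * Real.exp t)) := by
    have h := (hp.mul_const (Real.exp t)).div
      ((hpz.const_sub 1).add (hpz.mul_const (Real.exp t))) (by norm_num)
    rw [sub_zero, zero_mul, add_zero, div_one] at h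
    refine h.congr fun n => ?_
    simp only [Pi.div_apply]
    ring
  have hfree := tendsto_log_countExp θ (mul_pos hlam (Real.exp_pos t))
    (fun n => div_nonneg (mul_nonneg (hq0 n) (Real.exp_pos t).le) (hden n).le)
    (fun n => (div_le_one (hden n)).2 (by linarith [hq1 n])) htilt
  rw [Real.log_mul hlam.ne' (Real.exp_pos t).ne', Real.log_exp, ← add_assoc] at hfree
  have hlog : Tendsto (fun n : ℕ => n * Real.log (1 + q n * (Real.exp t - 1))) atTop
      (𝓝 (lam * (Real.exp t - 1))) := by
    have hup := hp.mul_const (Real.exp t - 1)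
    have hlow := hup.div ((hpz.mul_const (Real.exp t - 1)).const_add 1) (by simp)
    rw [zero_mul, add_zero, div_one] at hlow
    refine tendsto_of_tendsto_of_tendsto_of_le_of_le hlow hup (fun n => ?_) fun n => ?_
    · have hpos : 0 < 1 + q n * (Real.exp t - 1) := by linarith [hden n]
      have h := mul_le_mul_of_nonneg_left (Real.one_sub_inv_le_log_of_pos hpos)
        (Nat.cast_nonneg (α := ℝ) n)
      refine le_trans (le_of_eq ?_) h
      simp only [Pi.div_apply]
      change n * q n * (Real.exp t - 1) / (1 + q n * (Real.exp t - 1)) = _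
      field_simp
      ring
    · have hpos : 0 < 1 + q n * (Real.exp t - 1) := by linarith [hden n]
      have h := mul_le_mul_of_nonneg_left (Real.log_le_sub_one_of_pos hpos)
        (Nat.cast_nonneg (α := ℝ) n)
      refine h.trans (le_of_eq ?_)
      change _ = n * q n * (Real.exp t - 1)
      ring
  have hhalf : Tendsto (fun n : ℕ => (1 - 1 / (n : ℝ)) / 2) atTop (𝓝 ((1 - 0) / 2)) :=
    ((tendsto_const_div_atTop_nhds_zero_nat 1).const_sub 1).div_const 2
  have h := (hhalf.mul hlog).add (hfree.sub
    (tendsto_log_countExp θ hlam (edgeProb_nonneg lam) (edgeProb_le_one lam) hp))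
  rw [show (1 - 0) / 2 * (lam * (Real.exp t - 1)) = lam * (Real.exp t - 1) / 2 by ring] at h
  refine h.congr' ?_
  filter_upwards [eventually_gt_atTop 0] with n hn
  have hn0 : (n : ℝ) ≠ 0 := by exact_mod_cast hn.ne'
  have hpos : 0 < graphExp (q n * Real.exp t / (1 - q n + q n * Real.exp t))
      fun G : SimpleGraph (Fin n) => criticalWeight θ n ^ triangleVertexCount G :=
    graphExp_pos (div_nonneg (mul_nonneg (hq0 n) (Real.exp_pos t).le) (hden n).le)
      ((div_le_one (hden n)).2 (by linarith [hq1 n])) fun G => pow_pos (criticalWeight_pos θ n) _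
  rw [graphExp_exp_edgeCount (hq0 n) (hq1 n), Real.log_mul (pow_pos (hden n) _).ne' hpos.ne',
    Real.log_pow, Nat.cast_choose_two, countExp,
    show 1 + q n * (Real.exp t - 1) = 1 - q n + q n * Real.exp t by ring]
  field_simp
  ring

end

end TriangleERGM

theorem theorem3p1 (θ lam : ℝ) (hlam : 0 < lam) :
    ∃ aStar ∈ Set.Ioo (0 : ℝ) 1,
      -- `aStar` is the unique maximizer of `Λ(·, θ, lam)` over `[0, 1]`
      IsMaxOn (fun a => TriangleERGM.rate a θ lam) (Set.Icc 0 1) aStar ∧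
      (∀ a ∈ Set.Icc (0 : ℝ) 1,
        IsMaxOn (fun a => TriangleERGM.rate a θ lam) (Set.Icc 0 1) a → a = aStar) ∧
      -- `(1 / n) log Z_n` converges to the maximum
      Tendsto
        (fun n : ℕ => 1 / (n : ℝ) *
          Real.log (TriangleERGM.partitionFunction lam (TriangleERGM.criticalBeta θ n) n))
        atTop (𝓝 (TriangleERGM.rate aStar θ lam)) ∧
      -- `V_T(G_n) / n` converges to `aStar` in probability
      TriangleERGM.TendstoInProb
        (fun n => TriangleERGM.ergm lam (TriangleERGM.criticalBeta θ n) n)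
        (fun n G => (TriangleERGM.triangleVertexCount G : ℝ) / n) aStar ∧
      -- `E(G_n) / n` converges to `lam / 2 + aStar` in probability
      TriangleERGM.TendstoInProb
        (fun n => TriangleERGM.ergm lam (TriangleERGM.criticalBeta θ n) n)
        (fun n G => (TriangleERGM.edgeCount G : ℝ) / n) (lam / 2 + aStar) := by
  have hmem := TriangleERGM.density_mem (θ + Real.log lam)
  have hrate := TriangleERGM.rate_density θ lam
  refine ⟨_, hmem, fun a ha => ?_, fun a ha hmax => ?_, ?_,
    TriangleERGM.tendstoInProb_triangleVertexCount θ hlam,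
    TriangleERGM.tendstoInProb_edgeCount θ hlam⟩
  · change TriangleERGM.rate a θ lam ≤ TriangleERGM.rate _ θ lam
    by_cases h : a = TriangleERGM.density (θ + Real.log lam)
    · rw [h]
    · rw [hrate]
      exact (TriangleERGM.rate_lt_pressure ha h).le
  · by_contra h
    have hle : TriangleERGM.rate _ θ lam ≤ TriangleERGM.rate a θ lam :=
      hmax ⟨hmem.1.le, hmem.2.le⟩
    rw [hrate] at hle
    exact absurd hle (not_le.2 (TriangleERGM.rate_lt_pressure ha h))
  · rw [hrate]
    simp only [TriangleERGM.partitionFunction_criticalBeta]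
    exact TriangleERGM.tendsto_log_countExp θ hlam (TriangleERGM.edgeProb_nonneg lam)
      (TriangleERGM.edgeProb_le_one lam) (TriangleERGM.tendsto_mul_edgeProb hlam)
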